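/- Matrices carry the operator norm induced by the Euclidean norms on $\mathbb{C}^n$, and for a bounded matrix function $A$ we write $\|A\|$ for the supremum of its matrix norm over its domain. A system $\partial_x\psi=A(x)\psi$ with continuous $A\colon\mathbb{R}\to\mathrm{Mat}_{n\times n}(\mathbb{C})$ and evolution operator $T(x,y)$ has an exponential dichotomy on $\mathbb{R}$ with constants $K,\mu>0$ if there are projections $P(x)$, $x\in\mathbb{R}$, with $P(x)T(x,y)=T(x,y)P(y)$ for all $x,y$, $\|T(x,y)P(y)\|\le Ke^{-\mu(x-y)}$ for $x\ge y$ and $\|T(x,y)(I-P(y))\|\le Ke^{-\mu(y-x)}$ for $y\ge x$. **Theorem.** Let $n_1,n_2\in\mathbb{Z}_{>0}$, $\epsilon_0>0$, and let $A_{ij}\colon\mathbb{R}\times(0,\epsilon_0)\to\mathrm{Mat}_{n_i\times n_j}(\mathbb{C})$, $i,j=1,2$, be bounded and continuous. Assume that for every $\epsilon\in(0,\epsilon_0)$ the system $\partial_x\psi=A_{22}(x,\epsilon)\psi$ has an exponential dichotomy on $\mathbb{R}$ with constants $K_0,\mu_0>0$ independent of $\epsilon$. Then for all sufficiently small $\epsilon>0$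 there exist continuously differentiable functions $U_\epsilon\colon\mathbb{R}\to\mathrm{Mat}_{n_2\times n_1}(\mathbb{C})$ and $S_\epsilon\colon\mathbb{R}\to\mathrm{Mat}_{n_1\times n_2}(\mathbb{C})$ satisfying $$\partial_xU=A_{22}U-\epsilon UA_{11}-\epsilon UA_{12}U+A_{21},\qquad \partial_xS=\epsilon(A_{11}+A_{12}U)S-S(A_{22}-\epsilon UA_{12})-A_{12},$$ with the following properties. 1. $\|U_\epsilon\|\le 8K_0\mu_0^{-1}\|A_{21}\|$ and $\|S_\epsilon\|\le 8C_1\mu_0^{-1}\|A_{12}\|$, where $C_1>0$ depends on $K_0$ only. 2. The coordinate change $$\begin{pmatrix}\phi\\ \psi\end{pmatrix}=H_\epsilon(x)\begin{pmatrix}\chi\\ \omega\end{pmatrix},\qquad H_\epsilon(x)=\begin{pmatrix}I&-\epsilon S_\epsilon(x)\\ U_\epsilon(x)&I-\epsilon U_\epsilon(x)S_\epsilon(x)\end{pmatrix},$$ is invertible for every $x\in\mathbb{R}$ and transforms the system $\partial_x\phi=\epsilon(A_{11}\phi+A_{12}\psi)$, $\partial_x\psi=A_{21}\phi+A_{22}\psi$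 into the block-diagonal system $\partial_x\chi=\epsilon(A_{11}+A_{12}U_\epsilon)\chi$, $\partial_x\omega=(A_{22}-\epsilon U_\epsilon A_{12})\omega$; that is, $(\chi,\omega)$ solves the latter if and only if $(\phi,\psi)$ solves the former. 3. The equation $\partial_x\Omega=A_{22}(x,\epsilon)\Omega+A_{21}(x,\epsilon)$ has a unique bounded solution $\Omega_\epsilon\colon\mathbb{R}\to\mathrm{Mat}_{n_2\times n_1}(\mathbb{C})$, and for every $\theta\in(0,1)$ and $x\in\mathbb{R}$ $$\|U_\epsilon(x)-\Omega_\epsilon(x)\|\le C_3\,\epsilon^{1-\theta},$$ where $C_3>0$ depends on $K_0,\mu_0,\|A_{11}\|,\|A_{12}\|,\|A_{21}\|$ only. 4. For every $a>0$ and $x\in\mathbb{R}$ $$\|U_\epsilon(x)\|\le\frac{4K_0}{\mu_0}\Bigl[\sup_{y\in[x-a,x+a]}\bigl(\epsilon\|A_{12}\|\,\|U_\epsilon(y)\|^2+\|A_{21}(y,\epsilon)\|\bigr)+C_4e^{-a\mu_0/2}\Bigr],$$ where $C_4>0$ depends on $K_0,\mu_0,\|A_{12}\|,\|A_{21}\|$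 only. 5. If the matrix functions $A_{ij}(\cdot,\epsilon)$, $1\le i,j\le2$, are $L$-periodic, then $H_\epsilon$ is $L$-periodic. -/

import Mathlib

/- All matrices carry the operator norm induced by the Euclidean norms. -/
open scoped Matrix Matrix.Norms.L2Operator BoundedContinuousFunction

namespace SlowFast

/-- `z` is a solution on `ℝ` of the linear system `z' = M(x) z`. -/
def IsSolution {ι : Type} [Fintype ι] (M : ℝ → Matrix ι ι ℂ) (z : ℝ → ι → ℂ) : Prop :=
  ∀ x, HasDerivAt z (M x *ᵥ z x) x

/-- `T(x,y)` is the evolution operator of `z' = M(x) z`. -/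
def IsEvolution {n : ℕ} (M : ℝ → Matrix (Fin n) (Fin n) ℂ)
    (T : ℝ → ℝ → Matrix (Fin n) (Fin n) ℂ) : Prop :=
  ∀ y, T y y = 1 ∧ ∀ x, HasDerivAt (fun s => T s y) (M x * T x y) x

/-- The system `z' = M(x) z` has an exponential dichotomy on `ℝ` with constants `K, μ`. -/
def HasExpDichotomy {n : ℕ} (M : ℝ → Matrix (Fin n) (Fin n) ℂ) (K μ : ℝ) : Prop :=
  ∃ (T : ℝ → ℝ → Matrix (Fin n) (Fin n) ℂ) (P : ℝ → Matrix (Fin n) (Fin n) ℂ),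
    IsEvolution M T ∧
    (∀ x, P x * P x = P x) ∧
    (∀ x y, P x * T x y = T x y * P y) ∧
    (∀ x y, y ≤ x → ‖T x y * P y‖ ≤ K * Real.exp (-μ * (x - y))) ∧
    (∀ x y, x ≤ y → ‖T x y * (1 - P y)‖ ≤ K * Real.exp (-μ * (y - x)))

/-- The coordinate change `z = H(x) w` is invertible and turns the system `z' = M(x) z` into the
system `w' = N(x) w`. -/
def Transforms {ι : Type} [Fintype ι] [DecidableEq ι] (H M N : ℝ → Matrix ι ι ℂ) : Prop :=
  (∀ x, IsUnit (H x)) ∧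
    ∀ w : ℝ → ι → ℂ, IsSolution N w ↔ IsSolution M (fun x => H x *ᵥ w x)

section

variable {n₁ n₂ : ℕ} (ε : ℝ)
  (A₁₁ : ℝ → Matrix (Fin n₁) (Fin n₁) ℂ) (A₁₂ : ℝ → Matrix (Fin n₁) (Fin n₂) ℂ)
  (A₂₁ : ℝ → Matrix (Fin n₂) (Fin n₁) ℂ) (A₂₂ : ℝ → Matrix (Fin n₂) (Fin n₂) ℂ)
  (U : ℝ → Matrix (Fin n₂) (Fin n₁) ℂ) (S : ℝ → Matrix (Fin n₁) (Fin n₂) ℂ)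

/-- Coefficient matrix of the coupled system
`φ' = ε (A₁₁ φ + A₁₂ ψ)`, `ψ' = A₂₁ φ + A₂₂ ψ`. -/
def coupled (x : ℝ) : Matrix (Fin n₁ ⊕ Fin n₂) (Fin n₁ ⊕ Fin n₂) ℂ :=
  Matrix.fromBlocks ((ε : ℂ) • A₁₁ x) ((ε : ℂ) • A₁₂ x) (A₂₁ x) (A₂₂ x)

/-- Coefficient matrix of the decoupled system
`χ' = ε (A₁₁ + A₁₂ U) χ`, `ω' = (A₂₂ - ε U A₁₂) ω`. -/
def decoupled (x : ℝ) : Matrix (Fin n₁ ⊕ Fin n₂) (Fin n₁ ⊕ Fin n₂) ℂ :=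
  Matrix.fromBlocks ((ε : ℂ) • (A₁₁ x + A₁₂ x * U x)) 0 0 (A₂₂ x - (ε : ℂ) • (U x * A₁₂ x))

/-- The Riccati transformation `H`. -/
def riccatiTransform (x : ℝ) : Matrix (Fin n₁ ⊕ Fin n₂) (Fin n₁ ⊕ Fin n₂) ℂ :=
  Matrix.fromBlocks 1 (-((ε : ℂ) • S x)) (U x) (1 - (ε : ℂ) • (U x * S x))

/-- `U` and `S` are continuously differentiable solutions of the matrix Riccati equations. -/
def IsRiccatiPair : Prop :=
  ContDiff ℝ 1 U ∧ ContDiff ℝ 1 S ∧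
  (∀ x, HasDerivAt U
    (A₂₂ x * U x - (ε : ℂ) • (U x * A₁₁ x) - (ε : ℂ) • (U x * A₁₂ x * U x) + A₂₁ x) x) ∧
  (∀ x, HasDerivAt S
    ((ε : ℂ) • ((A₁₁ x + A₁₂ x * U x) * S x) - S x * (A₂₂ x - (ε : ℂ) • (U x * A₁₂ x)) - A₁₂ x) x)

/-- `Ω` is a bounded solution of `Ω' = A₂₂ Ω + A₂₁`. -/
def IsBoundedInhomSolution (Ω : ℝ → Matrix (Fin n₂) (Fin n₁) ℂ) : Prop :=
  (∃ B : ℝ, ∀ x, ‖Ω x‖ ≤ B) ∧ ∀ x, HasDerivAt Ω (A₂₂ x * Ω x + A₂₁ x) x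

end

end SlowFast

/-! An exponential dichotomy with constants `K`, `μ` makes `∂ₓ - A₂₂` invertible on bounded
functions: the inverse is integration against Green's function, which is at most
`K exp (-μ |x - y|)`, so its norm is at most `2K/μ`. The Riccati equation for `U` and, once `U` is
known, the equation for the conjugate transpose of `S` (whose linear part `-A₂₂ᴴ` inherits the
dichotomy with the projections `1 - Pᴴ`) are perturbations of `∂ₓ - A₂₂` and `∂ₓ + A₂₂ᴴ` by terms
that are `O(ε)`-Lipschitz on a ball, so for small `ε` each has exactly one solution in its ball;
periodicity is a consequence of uniqueness. Subtracting the equation for `Ω` from that for `U`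
leaves a forcing of size `O(ε)`, and `ε ≤ ε ^ (1 - θ)` for `ε ≤ 1`. For the local estimate, the
solution is compared with the weight `c₁ + d cosh (μ (y - x) / 2)`, which integration against
`exp (-μ |x - y|)` reproduces up to a factor `8/(3μ)`: its value at the centre `x` is `c₁ + d`,
while with `d` of size `exp (-a μ / 2)` it dominates the global bound on the forcing outside
`[x - a, x + a]`.
-/

namespace SlowFast

open Set Filter Topology MeasureTheory

section MatrixCalculus

section Derivatives

variable {l m n p : Type*} [Finite n]

theorem hasDerivAt_matrix_iff {A : ℝ → Matrix l n ℂ} {A' : Matrix l n ℂ} {x : ℝ} :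
    HasDerivAt A A' x ↔ ∀ i j, HasDerivAt (fun t => A t i j) (A' i j) x :=
  have := Fintype.ofFinite n
  (hasDerivAt_pi (E' := fun _ : l => n → ℂ)).trans (forall_congr' fun _ => hasDerivAt_pi)

theorem hasDerivAt_matrix_mul [Fintype m] {A : ℝ → Matrix l m ℂ} {B : ℝ → Matrix m n ℂ}
    {A' : Matrix l m ℂ} {B' : Matrix m n ℂ} {x : ℝ} (hA : HasDerivAt A A' x)
    (hB : HasDerivAt B B' x) : HasDerivAt (fun t => A t * B t) (A' * B x + A x * B') x := by
  rw [hasDerivAt_matrix_iff] at *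
  intro i j
  simp only [Matrix.mul_apply, Matrix.add_apply, ← Finset.sum_add_distrib]
  exact HasDerivAt.fun_sum fun k _ => (hA i k).mul (hB k j)

theorem hasDerivAt_matrix_mulVec [Fintype m] {A : ℝ → Matrix l m ℂ} {z : ℝ → m → ℂ}
    {A' : Matrix l m ℂ} {z' : m → ℂ} {x : ℝ} (hA : HasDerivAt A A' x) (hz : HasDerivAt z z' x) :
    HasDerivAt (fun t => A t *ᵥ z t) (A' *ᵥ z x + A x *ᵥ z') x := by
  rw [hasDerivAt_matrix_iff] at hA
  rw [hasDerivAt_pi] at hz ⊢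
  intro i
  simp only [Matrix.mulVec, dotProduct, Pi.add_apply, ← Finset.sum_add_distrib]
  exact HasDerivAt.fun_sum fun k _ => (hA i k).mul (hz k)

theorem hasDerivAt_matrix_conjTranspose [Finite m] {A : ℝ → Matrix m n ℂ} {A' : Matrix m n ℂ}
    {x : ℝ} (hA : HasDerivAt A A' x) : HasDerivAt (fun t => (A t)ᴴ) A'ᴴ x := by
  rw [hasDerivAt_matrix_iff] at *
  exact fun i j => (hA j i).star

theorem hasDerivAt_matrix_fromBlocks [Finite m] {A : ℝ → Matrix l m ℂ} {B : ℝ → Matrix l n ℂ}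
    {C : ℝ → Matrix p m ℂ} {D : ℝ → Matrix p n ℂ} {A' : Matrix l m ℂ} {B' : Matrix l n ℂ}
    {C' : Matrix p m ℂ} {D' : Matrix p n ℂ} {x : ℝ} (hA : HasDerivAt A A' x)
    (hB : HasDerivAt B B' x) (hC : HasDerivAt C C' x) (hD : HasDerivAt D D' x) :
    HasDerivAt (fun t => Matrix.fromBlocks (A t) (B t) (C t) (D t))
      (Matrix.fromBlocks A' B' C' D') x := by
  rw [hasDerivAt_matrix_iff] at *
  rintro (i | i) (j | j)
  exacts [hA i j, hB i j, hC i j, hD i j]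

end Derivatives

variable {l m n : Type*} [Fintype l] [Fintype m] [Fintype n] [DecidableEq n]

theorem contDiff_one_of_hasDerivAt {A A' : ℝ → Matrix l n ℂ} (h : ∀ x, HasDerivAt A (A' x) x)
    (hc : Continuous A') : ContDiff ℝ 1 A := by
  rw [contDiff_one_iff_deriv]
  exact ⟨fun x => (h x).differentiableAt, (funext fun x => (h x).deriv : deriv A = A') ▸ hc⟩

theorem norm_mul_le_of_le [DecidableEq m] {A : Matrix l m ℂ} {B : Matrix m n ℂ} {a b : ℝ}
    (hA : ‖A‖ ≤ a) (hB : ‖B‖ ≤ b) : ‖A * B‖ ≤ a * b :=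
  (Matrix.l2_opNorm_mul A B).trans (mul_le_mul hA hB (norm_nonneg _) ((norm_nonneg _).trans hA))

theorem norm_ofReal_smul_le {ε a : ℝ} (hε : 0 ≤ ε) {A : Matrix l n ℂ} (hA : ‖A‖ ≤ a) :
    ‖(ε : ℂ) • A‖ ≤ ε * a := by
  rw [norm_smul, Complex.norm_of_nonneg hε]
  exact mul_le_mul_of_nonneg_left hA hε

/-- Complex matrices with the operator norm, as a real normed space. The scalar multiplication is
the entrywise one, which is the one that `HasDerivAt` sees; it is not definitionally equal to that
of the instance obtained by restricting scalars from `ℂ`. -/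
@[reducible] noncomputable def realNormedSpace : NormedSpace ℝ (Matrix l n ℂ) where
  norm_smul_le r A := by
    have smul_eq_complex_smul : r • A = (r : ℂ) • A := by ext i j; simp
    rw [smul_eq_complex_smul, norm_smul, Complex.norm_real]

attribute [local instance] realNormedSpace

variable {α : Type*} [MeasurableSpace α] {ν : Measure α} {f : α → Matrix m n ℂ}

theorem integrable_matrix_mul_left (A : Matrix l m ℂ) (hf : Integrable f ν) :
    Integrable (fun y => A * f y) ν :=
  (mulLeftLinearMap n ℝ A).toContinuousLinearMap.integrable_comp hf

theorem integral_matrix_mul_left (A : Matrix l m ℂ) (hf : Integrable f ν) :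
    ∫ y, A * f y ∂ν = A * ∫ y, f y ∂ν :=
  (mulLeftLinearMap n ℝ A).toContinuousLinearMap.integral_comp_comm hf

end MatrixCalculus

section ExponentialKernel

variable {E : Type*} [NormedAddCommGroup E] [NormedSpace ℝ E] [CompleteSpace E] {f : ℝ → E}

theorem hasDerivAt_integral_Iic (hc : Continuous f) (hi : ∀ x, IntegrableOn f (Iic x)) (x : ℝ) :
    HasDerivAt (fun t => ∫ y in Iic t, f y) (f x) x := by
  have split_at_zero : (fun t => ∫ y in Iic t, f y) =
      fun t => (∫ y in Iic (0 : ℝ), f y) + ∫ y in (0 : ℝ)..t, f y := by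
    ext t
    rw [← intervalIntegral.integral_Iic_sub_Iic (hi 0) (hi t), add_sub_cancel]
  rw [split_at_zero]
  exact (intervalIntegral.integral_hasDerivAt_right (hc.intervalIntegrable _ _)
    (hc.stronglyMeasurableAtFilter _ _) hc.continuousAt).const_add _

theorem hasDerivAt_integral_Ioi (hc : Continuous f) (hi : ∀ x, IntegrableOn f (Ioi x)) (x : ℝ) :
    HasDerivAt (fun t => ∫ y in Ioi t, f y) (-f x) x := by
  have split_at_zero : (fun t => ∫ y in Ioi t, f y) =
      fun t => (∫ y in Ioi (0 : ℝ), f y) - ∫ y in (0 : ℝ)..t, f y := by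
    ext t
    rw [← intervalIntegral.integral_Ioi_sub_Ioi' (hi 0) (hi t), sub_sub_cancel]
  rw [split_at_zero]
  exact (intervalIntegral.integral_hasDerivAt_right (hc.intervalIntegrable _ _)
    (hc.stronglyMeasurableAtFilter _ _) hc.continuousAt).const_sub _

variable {μ κ : ℝ}

theorem exp_kernel_eqOn_Iic (x : ℝ) :
    EqOn (fun y => Real.exp (-μ * |x - y|) * Real.exp (κ * y))
      (fun y => Real.exp (-μ * x) * Real.exp ((μ + κ) * y)) (Iic x) := fun y hy => by
  simp only [abs_of_nonneg (sub_nonneg.2 (mem_Iic.1 hy)), ← Real.exp_add]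
  ring_nf

theorem exp_kernel_eqOn_Ioi (x : ℝ) :
    EqOn (fun y => Real.exp (-μ * |x - y|) * Real.exp (κ * y))
      (fun y => Real.exp (μ * x) * Real.exp (-(μ - κ) * y)) (Ioi x) := fun y hy => by
  simp only [abs_of_neg (sub_neg.2 (mem_Ioi.1 hy)), ← Real.exp_add]
  ring_nf

theorem integrableOn_exp_kernel_Iic (h : 0 < μ + κ) (x : ℝ) :
    IntegrableOn (fun y => Real.exp (-μ * |x - y|) * Real.exp (κ * y)) (Iic x) :=
  IntegrableOn.congr_fun ((integrableOn_exp_mul_Iic h x).const_mul _) (exp_kernel_eqOn_Iic x).symm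
    measurableSet_Iic

theorem integrableOn_exp_kernel_Ioi (h : 0 < μ - κ) (x : ℝ) :
    IntegrableOn (fun y => Real.exp (-μ * |x - y|) * Real.exp (κ * y)) (Ioi x) :=
  IntegrableOn.congr_fun ((integrableOn_exp_mul_Ioi (neg_lt_zero.2 h) x).const_mul _)
    (exp_kernel_eqOn_Ioi x).symm measurableSet_Ioi

theorem integrable_exp_kernel_mul_exp (h : |κ| < μ) (x : ℝ) :
    Integrable fun y => Real.exp (-μ * |x - y|) * Real.exp (κ * y) := by
  obtain ⟨h₁, h₂⟩ := abs_lt.1 h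
  rw [← integrableOn_univ, ← Iic_union_Ioi (a := x)]
  exact (integrableOn_exp_kernel_Iic (by linarith) x).union
    (integrableOn_exp_kernel_Ioi (by linarith) x)

theorem integral_exp_kernel_mul_exp (h : |κ| < μ) (x : ℝ) :
    ∫ y, Real.exp (-μ * |x - y|) * Real.exp (κ * y) =
      2 * μ / (μ ^ 2 - κ ^ 2) * Real.exp (κ * x) := by
  obtain ⟨h₁, h₂⟩ := abs_lt.1 h
  have hp : 0 < μ + κ := by linarith
  have hm : 0 < μ - κ := by linarith
  have left_half : Real.exp (-μ * x) * Real.exp ((μ + κ) * x) = Real.exp (κ * x) := by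
    rw [← Real.exp_add]; ring_nf
  have right_half : Real.exp (μ * x) * Real.exp (-(μ - κ) * x) = Real.exp (κ * x) := by
    rw [← Real.exp_add]; ring_nf
  rw [← intervalIntegral.integral_Iic_add_Ioi (integrableOn_exp_kernel_Iic hp x)
      (integrableOn_exp_kernel_Ioi hm x),
    setIntegral_congr_fun measurableSet_Iic (exp_kernel_eqOn_Iic x),
    setIntegral_congr_fun measurableSet_Ioi (exp_kernel_eqOn_Ioi x), integral_const_mul,
    integral_const_mul, integral_exp_mul_Iic hp, integral_exp_mul_Ioi (neg_lt_zero.2 hm),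
    neg_div_neg_eq, ← mul_div_assoc, ← mul_div_assoc, left_half, right_half,
    show μ ^ 2 - κ ^ 2 = (μ + κ) * (μ - κ) by ring]
  field_simp
  ring

theorem integrable_exp_kernel (hμ : 0 < μ) (x : ℝ) :
    Integrable fun y => Real.exp (-μ * |x - y|) := by
  simpa using integrable_exp_kernel_mul_exp (κ := 0) (by simpa using hμ) x

theorem integral_exp_kernel (hμ : 0 < μ) (x : ℝ) : ∫ y, Real.exp (-μ * |x - y|) = 2 / μ := by
  have unweighted := integral_exp_kernel_mul_exp (κ := 0) (by simpa using hμ) x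
  simp only [zero_mul, Real.exp_zero, mul_one, zero_pow two_ne_zero, sub_zero] at unweighted
  rw [unweighted]
  field_simp

theorem exp_kernel_mul_cosh (x c y : ℝ) :
    Real.exp (-μ * |x - y|) * Real.cosh (κ * (y - c)) =
      Real.exp (-(κ * c)) / 2 * (Real.exp (-μ * |x - y|) * Real.exp (κ * y)) +
        Real.exp (κ * c) / 2 * (Real.exp (-μ * |x - y|) * Real.exp (-κ * y)) := by
  rw [Real.cosh_eq, show κ * (y - c) = -(κ * c) + κ * y by ring,
    show -(-(κ * c) + κ * y) = κ * c + -κ * y by ring, Real.exp_add, Real.exp_add]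
  ring

theorem integrable_exp_kernel_mul_cosh (h : |κ| < μ) (c x : ℝ) :
    Integrable fun y => Real.exp (-μ * |x - y|) * Real.cosh (κ * (y - c)) := by
  simp only [exp_kernel_mul_cosh]
  exact ((integrable_exp_kernel_mul_exp h x).const_mul _).add
    ((integrable_exp_kernel_mul_exp (by rwa [abs_neg]) x).const_mul _)

theorem integral_exp_kernel_mul_cosh (h : |κ| < μ) (c x : ℝ) :
    ∫ y, Real.exp (-μ * |x - y|) * Real.cosh (κ * (y - c)) =
      2 * μ / (μ ^ 2 - κ ^ 2) * Real.cosh (κ * (x - c)) := by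
  have h' : |-κ| < μ := by rwa [abs_neg]
  simp only [exp_kernel_mul_cosh]
  rw [integral_add ((integrable_exp_kernel_mul_exp h x).const_mul _)
      ((integrable_exp_kernel_mul_exp h' x).const_mul _),
    integral_const_mul, integral_const_mul, integral_exp_kernel_mul_exp h,
    integral_exp_kernel_mul_exp h', Real.cosh_eq, show κ * (x - c) = -(κ * c) + κ * x by ring,
    show -(-(κ * c) + κ * x) = κ * c + -κ * x by ring, Real.exp_add, Real.exp_add, neg_sq]
  ring

theorem exp_kernel_mul_add_cosh (c d x₀ x y : ℝ) :
    Real.exp (-μ * |x - y|) * (c + d * Real.cosh (κ * (y - x₀))) =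
      c * Real.exp (-μ * |x - y|) +
        d * (Real.exp (-μ * |x - y|) * Real.cosh (κ * (y - x₀))) := by ring

theorem integrable_exp_kernel_mul_add_cosh (h : |κ| < μ) (c d x₀ x : ℝ) :
    Integrable fun y => Real.exp (-μ * |x - y|) * (c + d * Real.cosh (κ * (y - x₀))) := by
  simp only [exp_kernel_mul_add_cosh]
  exact ((integrable_exp_kernel ((abs_nonneg κ).trans_lt h) x).const_mul c).add
    ((integrable_exp_kernel_mul_cosh h x₀ x).const_mul d)

theorem integral_exp_kernel_mul_add_cosh_le (h : |κ| < μ) {c : ℝ} (hc : 0 ≤ c) (d x₀ x : ℝ) :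
    ∫ y, Real.exp (-μ * |x - y|) * (c + d * Real.cosh (κ * (y - x₀))) ≤
      2 * μ / (μ ^ 2 - κ ^ 2) * (c + d * Real.cosh (κ * (x - x₀))) := by
  have hμ : 0 < μ := (abs_nonneg κ).trans_lt h
  have sq_lt : κ ^ 2 < μ ^ 2 := sq_lt_sq.2 (by rwa [abs_of_pos hμ])
  have mass_le : 2 / μ ≤ 2 * μ / (μ ^ 2 - κ ^ 2) := by
    rw [div_le_div_iff₀ hμ (sub_pos.2 sq_lt)]
    nlinarith [sq_nonneg κ]
  simp only [exp_kernel_mul_add_cosh]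
  rw [integral_add ((integrable_exp_kernel hμ x).const_mul c)
      ((integrable_exp_kernel_mul_cosh h x₀ x).const_mul d), integral_const_mul,
    integral_const_mul, integral_exp_kernel hμ, integral_exp_kernel_mul_cosh h]
  linarith [mul_le_mul_of_nonneg_left mass_le hc]

theorem one_le_two_mul_exp_mul_cosh {s t : ℝ} (h : s ≤ |t|) :
    1 ≤ 2 * Real.exp (-s) * Real.cosh t := by
  have two_mul_cosh : Real.exp t + Real.exp (-t) = 2 * Real.cosh t := by
    rw [Real.cosh_eq]; ring
  calc
    1 = Real.exp (-s) * Real.exp s := by rw [← Real.exp_add, neg_add_cancel, Real.exp_zero]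
    _ ≤ Real.exp (-s) * (2 * Real.cosh t) := by
      gcongr
      exact (Real.exp_le_exp.2 h).trans ((Real.exp_abs_le t).trans_eq two_mul_cosh)
    _ = 2 * Real.exp (-s) * Real.cosh t := by ring

theorem le_add_mul_cosh {c₁ c₂ r s t : ℝ} (hc₁ : 0 ≤ c₁) (hc₂ : 0 ≤ c₂) (hr : r ≤ c₂)
    (hr_local : |t| ≤ s → r ≤ c₁) : r ≤ c₁ + 2 * c₂ * Real.exp (-s) * Real.cosh t := by
  rcases le_total |t| s with ht | ht
  · exact (hr_local ht).trans (le_add_of_nonneg_right (by positivity))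
  · calc
      r ≤ c₂ * (2 * Real.exp (-s) * Real.cosh t) :=
        hr.trans (le_mul_of_one_le_right hc₂ (one_le_two_mul_exp_mul_cosh ht))
      _ = 2 * c₂ * Real.exp (-s) * Real.cosh t := by ring
      _ ≤ c₁ + 2 * c₂ * Real.exp (-s) * Real.cosh t := le_add_of_nonneg_left hc₁

variable {F : Type*} [NormedAddCommGroup F] {g : ℝ → F} {C : ℝ}

theorem integrable_exp_kernel_mul_norm (hμ : 0 < μ) (hg : Continuous g) (hC : ∀ x, ‖g x‖ ≤ C)
    (x : ℝ) : Integrable fun y => Real.exp (-μ * |x - y|) * ‖g y‖ :=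
  (integrable_exp_kernel hμ x).mul_bdd hg.norm.aestronglyMeasurable
    (.of_forall fun y => (norm_norm (g y)).trans_le (hC y))

theorem integral_exp_kernel_mul_norm_le (hμ : 0 < μ) (hg : Continuous g) (hC : ∀ x, ‖g x‖ ≤ C)
    (x : ℝ) : ∫ y, Real.exp (-μ * |x - y|) * ‖g y‖ ≤ 2 / μ * C := by
  rw [← integral_exp_kernel hμ x, ← integral_mul_const]
  exact integral_mono (integrable_exp_kernel_mul_norm hμ hg hC x)
    ((integrable_exp_kernel hμ x).mul_const C) fun y => by
      gcongr
      exact hC y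

end ExponentialKernel

section Evolution

attribute [local instance] realNormedSpace

theorem eq_of_hasDerivAt_linear {ι κ : Type*} [Fintype ι] [Finite κ] {M : ℝ → Matrix ι ι ℂ}
    (hM : Continuous M) {V W : ℝ → Matrix ι κ ℂ}
    (hV : ∀ x, HasDerivAt V (M x * V x) x) (hW : ∀ x, HasDerivAt W (M x * W x) x) {y : ℝ}
    (h : V y = W y) : V = W := by
  classical
  have := Fintype.ofFinite κ
  ext1 x
  set r := max |x| |y| + 1
  have mem_Ioo : ∀ t, |t| ≤ max |x| |y| → t ∈ Ioo (-r) r := fun t ht =>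
    abs_lt.1 (ht.trans_lt (lt_add_one _))
  obtain ⟨C, hC⟩ := isCompact_Icc.exists_bound_of_continuousOn (s := Icc (-r) r) hM.continuousOn
  have lipschitz : ∀ t ∈ Ioo (-r) r, LipschitzOnWith C.toNNReal (fun A : Matrix ι κ ℂ => M t * A)
      univ := fun t ht => by
    refine (LipschitzWith.of_dist_le_mul fun A B => ?_).lipschitzOnWith
    rw [dist_eq_norm, dist_eq_norm, ← Matrix.mul_sub]
    exact norm_mul_le_of_le ((hC t (Ioo_subset_Icc_self ht)).trans (Real.le_coe_toNNReal C)) le_rfl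
  exact ODE_solution_unique_of_mem_Ioo lipschitz (mem_Ioo y (le_max_right _ _))
    (fun t _ => ⟨hV t, mem_univ _⟩) (fun t _ => ⟨hW t, mem_univ _⟩) h (mem_Ioo x (le_max_left _ _))

variable {n : ℕ} {M : ℝ → Matrix (Fin n) (Fin n) ℂ} {T : ℝ → ℝ → Matrix (Fin n) (Fin n) ℂ}

namespace IsEvolution

theorem eq_mul {κ : Type*} [Finite κ] (hT : IsEvolution M T) (hM : Continuous M)
    {V : ℝ → Matrix (Fin n) κ ℂ} (hV : ∀ x, HasDerivAt V (M x * V x) x) (x y : ℝ) :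
    V x = T x y * V y := by
  classical
  have := Fintype.ofFinite κ
  refine congrFun (eq_of_hasDerivAt_linear hM hV (W := fun x => T x y * V y) (fun x => ?_)
    (y := y) ?_) x
  · simpa [Matrix.mul_assoc] using
      hasDerivAt_matrix_mul ((hT y).2 x) (hasDerivAt_const x (V y))
  · simp only [(hT y).1, Matrix.one_mul]

theorem mul_trans (hT : IsEvolution M T) (hM : Continuous M) (x y z : ℝ) :
    T x y * T y z = T x z :=
  (hT.eq_mul hM (hT z).2 x y).symm

theorem mul_symm (hT : IsEvolution M T) (hM : Continuous M) (x y : ℝ) : T x y * T y x = 1 := by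
  rw [hT.mul_trans hM, (hT x).1]

theorem eq_ringInverse (hT : IsEvolution M T) (hM : Continuous M) (x y : ℝ) :
    T x y = Ring.inverse (T y x) := by
  rw [← Matrix.nonsing_inv_eq_ringInverse, Matrix.inv_eq_left_inv (hT.mul_symm hM x y)]

theorem hasDerivAt_right (hT : IsEvolution M T) (hM : Continuous M) (x y : ℝ) :
    HasDerivAt (fun s => T x s) (-(T x y * M y)) y := by
  let u : (Matrix (Fin n) (Fin n) ℂ)ˣ := ⟨T y x, T x y, hT.mul_symm hM y x, hT.mul_symm hM x y⟩
  have inverse_deriv := (hasFDerivAt_ringInverse (𝕜 := ℝ) u).comp_hasDerivAt (f := fun s => T s x) y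
    ((hT x).2 y)
  have deriv_eq : (-ContinuousLinearMap.mulLeftRight ℝ (Matrix (Fin n) (Fin n) ℂ) ↑u⁻¹ ↑u⁻¹)
      (M y * T y x) = -(T x y * M y) := by
    change -(T x y * (M y * T y x) * T x y) = _
    rw [Matrix.mul_assoc, Matrix.mul_assoc, hT.mul_symm hM, Matrix.mul_one]
  rw [deriv_eq] at inverse_deriv
  exact inverse_deriv.congr_of_eventuallyEq (.of_forall fun s => hT.eq_ringInverse hM x s)

theorem continuous_right (hT : IsEvolution M T) (hM : Continuous M) (x : ℝ) :
    Continuous fun y => T x y :=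
  continuous_iff_continuousAt.2 fun y => (hT.hasDerivAt_right hM x y).continuousAt

theorem adjoint (hT : IsEvolution M T) (hM : Continuous M) :
    IsEvolution (fun x => -(M x)ᴴ) (fun x y => (T y x)ᴴ) := fun y => by
  refine ⟨by simp only [(hT y).1, Matrix.conjTranspose_one], fun x => ?_⟩
  simpa [Matrix.conjTranspose_mul] using
    hasDerivAt_matrix_conjTranspose (hT.hasDerivAt_right hM y x)

end IsEvolution

end Evolution

section Dichotomy

variable {n : ℕ} {κ : Type*} [Fintype κ] [DecidableEq κ] {M : ℝ → Matrix (Fin n) (Fin n) ℂ}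
  {T : ℝ → ℝ → Matrix (Fin n) (Fin n) ℂ} {P : ℝ → Matrix (Fin n) (Fin n) ℂ} {K μ : ℝ}

/-- The evolution operator `T` and the projections `P` realise an exponential dichotomy of
`z' = M(x) z` with constants `K`, `μ`: these are the data whose existence `HasExpDichotomy`
asserts. -/
structure IsDichotomy (M : ℝ → Matrix (Fin n) (Fin n) ℂ) (T : ℝ → ℝ → Matrix (Fin n) (Fin n) ℂ)
    (P : ℝ → Matrix (Fin n) (Fin n) ℂ) (K μ : ℝ) : Prop where
  isEvolution : IsEvolution M T
  idem : ∀ x, P x * P x = P x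
  comm : ∀ x y, P x * T x y = T x y * P y
  norm_stable_le : ∀ x y, y ≤ x → ‖T x y * P y‖ ≤ K * Real.exp (-μ * (x - y))
  norm_unstable_le : ∀ x y, x ≤ y → ‖T x y * (1 - P y)‖ ≤ K * Real.exp (-μ * (y - x))

theorem hasExpDichotomy_iff : HasExpDichotomy M K μ ↔ ∃ T P, IsDichotomy M T P K μ :=
  exists₂_congr fun _ _ => ⟨fun ⟨h₁, h₂, h₃, h₄, h₅⟩ => ⟨h₁, h₂, h₃, h₄, h₅⟩,
    fun ⟨h₁, h₂, h₃, h₄, h₅⟩ => ⟨h₁, h₂, h₃, h₄, h₅⟩⟩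

/-- Green's function of `V' = M(x) V + f(x)` belonging to a dichotomy: the kernel whose integral
against `f` is the bounded solution. The projection stands to the left of `T`, which by
commutation is the same as to its right. -/
noncomputable def greenFunction (T : ℝ → ℝ → Matrix (Fin n) (Fin n) ℂ)
    (P : ℝ → Matrix (Fin n) (Fin n) ℂ) (x y : ℝ) : Matrix (Fin n) (Fin n) ℂ :=
  if y ≤ x then P x * T x y else (P x - 1) * T x y

namespace IsDichotomy

theorem compl_comm (h : IsDichotomy M T P K μ) (x y : ℝ) :
    (1 - P x) * T x y = T x y * (1 - P y) := by
  rw [Matrix.sub_mul, Matrix.mul_sub, h.comm, Matrix.one_mul, Matrix.mul_one]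

theorem adjoint (h : IsDichotomy M T P K μ) (hM : Continuous M) :
    IsDichotomy (fun x => -(M x)ᴴ) (fun x y => (T y x)ᴴ) (fun x => (1 - P x)ᴴ) K μ where
  isEvolution := h.isEvolution.adjoint hM
  idem x := by
    rw [← Matrix.conjTranspose_mul, Matrix.sub_mul, Matrix.mul_sub, Matrix.mul_sub, h.idem]
    simp
  comm x y := by rw [← Matrix.conjTranspose_mul, ← Matrix.conjTranspose_mul, h.compl_comm]
  norm_stable_le x y hyx := by
    rw [← Matrix.conjTranspose_mul, Matrix.l2_opNorm_conjTranspose, h.compl_comm]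
    exact h.norm_unstable_le y x hyx
  norm_unstable_le x y hxy := by
    have compl_compl : 1 - (1 - P y)ᴴ = (P y)ᴴ := by simp
    rw [compl_compl, ← Matrix.conjTranspose_mul, Matrix.l2_opNorm_conjTranspose, h.comm]
    exact h.norm_stable_le y x hxy

theorem norm_greenFunction_le (h : IsDichotomy M T P K μ) (x y : ℝ) :
    ‖greenFunction T P x y‖ ≤ K * Real.exp (-μ * |x - y|) := by
  rw [greenFunction]
  split_ifs with hyx
  · rw [h.comm, abs_of_nonneg (sub_nonneg.2 hyx)]
    exact h.norm_stable_le x y hyx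
  · rw [← neg_sub 1, Matrix.neg_mul, norm_neg, h.compl_comm,
      abs_of_neg (sub_neg.2 (not_le.1 hyx)), neg_sub]
    exact h.norm_unstable_le x y (not_le.1 hyx).le

theorem eq_zero_of_bounded (h : IsDichotomy M T P K μ) (hM : Continuous M) (hμ : 0 < μ)
    {V : ℝ → Matrix (Fin n) κ ℂ} {C : ℝ} (hC : ∀ x, ‖V x‖ ≤ C)
    (hV : ∀ x, HasDerivAt V (M x * V x) x) : V = 0 := by
  ext1 x
  have norm_le : ∀ y, ‖greenFunction T P x y * V y‖ ≤ K * Real.exp (-μ * |x - y|) * C := fun y =>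
    norm_mul_le_of_le (h.norm_greenFunction_le x y) (hC y)
  have eq_mul := h.isEvolution.eq_mul hM hV x
  have bound_tendsto_zero : ∀ {l : Filter ℝ}, Tendsto (fun y => |x - y|) l atTop →
      Tendsto (fun y => K * Real.exp (-μ * |x - y|) * C) l (𝓝 0) := fun hl => by
    simpa using ((Real.tendsto_exp_atBot.comp
      (hl.const_mul_atTop_of_neg (neg_lt_zero.2 hμ))).const_mul K).mul_const C
  have stable_part : P x * V x = 0 := by
    refine norm_le_zero_iff.1 (ge_of_tendsto (bound_tendsto_zero
      (tendsto_abs_atTop_atTop.comp (tendsto_atTop_add_const_left _ x tendsto_neg_atBot_atTop))) ?_)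
    filter_upwards [eventually_le_atBot x] with y hy
    simpa only [greenFunction, if_pos hy, Matrix.mul_assoc, ← eq_mul] using norm_le y
  have unstable_part : (P x - 1) * V x = 0 := by
    refine norm_le_zero_iff.1 (ge_of_tendsto (bound_tendsto_zero
      (tendsto_abs_atBot_atTop.comp (tendsto_atBot_add_const_left _ x tendsto_neg_atTop_atBot))) ?_)
    filter_upwards [eventually_gt_atTop x] with y hy
    simpa only [greenFunction, if_neg hy.not_ge, Matrix.mul_assoc, ← eq_mul] using norm_le y
  simpa [Matrix.sub_mul, stable_part] using unstable_part


theorem mul_greenFunction_mul_eqOn_Iic {ι : Type*} (h : IsDichotomy M T P K μ)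
    (hM : Continuous M) (f : ℝ → Matrix (Fin n) ι ℂ) (x z : ℝ) :
    EqOn (fun y => T z x * (greenFunction T P x y * f y)) (fun y => P z * (T z y * f y))
      (Iic x) := fun y hy => by
  simp only [greenFunction, if_pos (mem_Iic.1 hy), ← Matrix.mul_assoc]
  rw [← h.comm, Matrix.mul_assoc (P z), h.isEvolution.mul_trans hM]

theorem mul_greenFunction_mul_eqOn_Ioi {ι : Type*} (h : IsDichotomy M T P K μ)
    (hM : Continuous M) (f : ℝ → Matrix (Fin n) ι ℂ) (x z : ℝ) :
    EqOn (fun y => T z x * (greenFunction T P x y * f y)) (fun y => (P z - 1) * (T z y * f y))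
      (Ioi x) := fun y hy => by
  have comm : T z x * (P x - 1) = (P z - 1) * T z x := by
    rw [← neg_sub 1, ← neg_sub 1, Matrix.neg_mul, Matrix.mul_neg, h.compl_comm]
  simp only [greenFunction, if_neg (mem_Ioi.1 hy).not_ge, ← Matrix.mul_assoc]
  rw [comm, Matrix.mul_assoc (P z - 1), h.isEvolution.mul_trans hM]

section Forcing

attribute [local instance] realNormedSpace

variable {f : ℝ → Matrix (Fin n) κ ℂ} {C : ℝ}

theorem norm_greenFunction_mul_le (h : IsDichotomy M T P K μ) (f : ℝ → Matrix (Fin n) κ ℂ)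
    (x y : ℝ) : ‖greenFunction T P x y * f y‖ ≤ K * (Real.exp (-μ * |x - y|) * ‖f y‖) :=
  (norm_mul_le_of_le (h.norm_greenFunction_le x y) le_rfl).trans_eq (mul_assoc _ _ _)

theorem integrable_greenFunction_mul (h : IsDichotomy M T P K μ) (hM : Continuous M) (hμ : 0 < μ)
    (hf : Continuous f) (hC : ∀ x, ‖f x‖ ≤ C) (x : ℝ) :
    Integrable fun y => greenFunction T P x y * f y := by
  refine ((integrable_exp_kernel_mul_norm hμ hf hC x).const_mul K).mono' ?_
    (.of_forall (h.norm_greenFunction_mul_le f x))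
  have branch_continuous : ∀ A : Matrix (Fin n) (Fin n) ℂ, Continuous fun y => A * T x y * f y :=
    fun A => (continuous_const.matrix_mul (h.isEvolution.continuous_right hM x)).matrix_mul hf
  have integrand_eq : (fun y => greenFunction T P x y * f y) =
      fun y => if y ∈ Iic x then P x * T x y * f y else (P x - 1) * T x y * f y := by
    ext1 y
    simp only [greenFunction, mem_Iic]
    split_ifs <;> rfl
  rw [integrand_eq]
  exact ((branch_continuous (P x)).stronglyMeasurable.ite measurableSet_Iic
    (branch_continuous (P x - 1)).stronglyMeasurable).aestronglyMeasurable

theorem norm_integral_greenFunction_mul_le (h : IsDichotomy M T P K μ) (hμ : 0 < μ)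
    (hf : Continuous f) (hC : ∀ x, ‖f x‖ ≤ C) (x : ℝ) :
    ‖∫ y, greenFunction T P x y * f y‖ ≤ K * ∫ y, Real.exp (-μ * |x - y|) * ‖f y‖ := by
  rw [← integral_const_mul]
  exact norm_integral_le_of_norm_le ((integrable_exp_kernel_mul_norm hμ hf hC x).const_mul K)
    (.of_forall (h.norm_greenFunction_mul_le f x))

theorem integrableOn_Iic_stable (h : IsDichotomy M T P K μ) (hM : Continuous M) (hμ : 0 < μ)
    (hf : Continuous f) (hC : ∀ x, ‖f x‖ ≤ C) (x z : ℝ) :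
    IntegrableOn (fun y => P z * (T z y * f y)) (Iic x) :=
  (integrable_matrix_mul_left (T z x) (h.integrable_greenFunction_mul hM hμ hf hC x)).integrableOn
    |>.congr_fun (h.mul_greenFunction_mul_eqOn_Iic hM f x z) measurableSet_Iic

theorem integrableOn_Ioi_unstable (h : IsDichotomy M T P K μ) (hM : Continuous M) (hμ : 0 < μ)
    (hf : Continuous f) (hC : ∀ x, ‖f x‖ ≤ C) (x z : ℝ) :
    IntegrableOn (fun y => (P z - 1) * (T z y * f y)) (Ioi x) :=
  (integrable_matrix_mul_left (T z x) (h.integrable_greenFunction_mul hM hμ hf hC x)).integrableOn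
    |>.congr_fun (h.mul_greenFunction_mul_eqOn_Ioi hM f x z) measurableSet_Ioi

-- At a fixed base point `z` the integrands no longer depend on `x`, so the right-hand side can be
-- differentiated by the fundamental theorem of calculus.
theorem integral_greenFunction_mul_eq (h : IsDichotomy M T P K μ) (hM : Continuous M) (hμ : 0 < μ)
    (hf : Continuous f) (hC : ∀ x, ‖f x‖ ≤ C) (x z : ℝ) :
    ∫ y, greenFunction T P x y * f y = T x z *
      ((∫ y in Iic x, P z * (T z y * f y)) + ∫ y in Ioi x, (P z - 1) * (T z y * f y)) := by
  have integrable := h.integrable_greenFunction_mul hM hμ hf hC x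
  have integrable_pulled_back := integrable_matrix_mul_left (T z x) integrable
  rw [← setIntegral_congr_fun measurableSet_Iic (h.mul_greenFunction_mul_eqOn_Iic hM f x z),
    ← setIntegral_congr_fun measurableSet_Ioi (h.mul_greenFunction_mul_eqOn_Ioi hM f x z),
    intervalIntegral.integral_Iic_add_Ioi integrable_pulled_back.integrableOn
      integrable_pulled_back.integrableOn,
    integral_matrix_mul_left _ integrable, ← Matrix.mul_assoc, h.isEvolution.mul_symm hM,
    Matrix.one_mul]

theorem hasDerivAt_integral_greenFunction_mul (h : IsDichotomy M T P K μ) (hM : Continuous M)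
    (hμ : 0 < μ) (hf : Continuous f) (hC : ∀ x, ‖f x‖ ≤ C) (x : ℝ) :
    HasDerivAt (fun x => ∫ y, greenFunction T P x y * f y)
      (M x * (∫ y, greenFunction T P x y * f y) + f x) x := by
  have g_continuous : Continuous fun y => T 0 y * f y :=
    (h.isEvolution.continuous_right hM 0).matrix_mul hf
  have jump : P 0 * (T 0 x * f x) + -((P 0 - 1) * (T 0 x * f x)) = T 0 x * f x := by
    rw [Matrix.sub_mul, Matrix.one_mul]; abel
  have deriv := hasDerivAt_matrix_mul ((h.isEvolution 0).2 x)
    ((hasDerivAt_integral_Iic (continuous_const.matrix_mul g_continuous)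
      (fun t => h.integrableOn_Iic_stable hM hμ hf hC t 0) x).add
    (hasDerivAt_integral_Ioi (continuous_const.matrix_mul g_continuous)
      (fun t => h.integrableOn_Ioi_unstable hM hμ hf hC t 0) x))
  rw [jump, ← Matrix.mul_assoc, h.isEvolution.mul_symm hM, Matrix.one_mul,
    Matrix.mul_assoc] at deriv
  simp only [h.integral_greenFunction_mul_eq hM hμ hf hC _ 0]
  exact deriv

end Forcing

end IsDichotomy

namespace HasExpDichotomy

theorem nonneg (h : HasExpDichotomy M K μ) : 0 ≤ K := by
  obtain ⟨T, P, hd⟩ := hasExpDichotomy_iff.1 h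
  simpa using (norm_nonneg _).trans (hd.norm_stable_le 0 0 le_rfl)

theorem adjoint (h : HasExpDichotomy M K μ) (hM : Continuous M) :
    HasExpDichotomy (fun x => -(M x)ᴴ) K μ :=
  let ⟨_, _, hd⟩ := hasExpDichotomy_iff.1 h
  hasExpDichotomy_iff.2 ⟨_, _, hd.adjoint hM⟩

variable {f V W : ℝ → Matrix (Fin n) κ ℂ} {B C : ℝ}

theorem eq_of_bounded (h : HasExpDichotomy M K μ) (hM : Continuous M) (hμ : 0 < μ)
    (hVB : ∀ x, ‖V x‖ ≤ B) (hWC : ∀ x, ‖W x‖ ≤ C) (hV : ∀ x, HasDerivAt V (M x * V x + f x) x)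
    (hW : ∀ x, HasDerivAt W (M x * W x + f x) x) : V = W := by
  obtain ⟨T, P, hd⟩ := hasExpDichotomy_iff.1 h
  refine sub_eq_zero.1 (hd.eq_zero_of_bounded hM hμ (C := B + C)
    (fun x => norm_sub_le_of_le (hVB x) (hWC x)) fun x => ?_)
  simpa [Matrix.mul_sub] using (hV x).sub (hW x)

theorem exists_bounded_solution (h : HasExpDichotomy M K μ) (hM : Continuous M) (hμ : 0 < μ)
    (hf : Continuous f) (hC : ∀ x, ‖f x‖ ≤ C) :
    ∃ V : ℝ → Matrix (Fin n) κ ℂ, (∀ x, ‖V x‖ ≤ K * ∫ y, Real.exp (-μ * |x - y|) * ‖f y‖) ∧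
      ∀ x, HasDerivAt V (M x * V x + f x) x :=
  let ⟨_, _, hd⟩ := hasExpDichotomy_iff.1 h
  ⟨_, hd.norm_integral_greenFunction_mul_le hμ hf hC,
    hd.hasDerivAt_integral_greenFunction_mul hM hμ hf hC⟩

theorem mul_integral_exp_kernel_mul_norm_le (h : HasExpDichotomy M K μ) (hμ : 0 < μ)
    (hf : Continuous f) (hC : ∀ x, ‖f x‖ ≤ C) (x : ℝ) :
    K * ∫ y, Real.exp (-μ * |x - y|) * ‖f y‖ ≤ 2 * K / μ * C :=
  (mul_le_mul_of_nonneg_left (integral_exp_kernel_mul_norm_le hμ hf hC x)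
    h.nonneg).trans_eq (by ring)

theorem norm_le_integral (h : HasExpDichotomy M K μ) (hM : Continuous M) (hμ : 0 < μ)
    (hf : Continuous f) (hC : ∀ x, ‖f x‖ ≤ C) (hVB : ∀ x, ‖V x‖ ≤ B)
    (hV : ∀ x, HasDerivAt V (M x * V x + f x) x) (x : ℝ) :
    ‖V x‖ ≤ K * ∫ y, Real.exp (-μ * |x - y|) * ‖f y‖ := by
  obtain ⟨W, norm_W_le, hW⟩ := h.exists_bounded_solution hM hμ hf hC
  rw [h.eq_of_bounded hM hμ hVB
    (fun x => (norm_W_le x).trans (h.mul_integral_exp_kernel_mul_norm_le hμ hf hC x)) hV hW]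
  exact norm_W_le x

theorem norm_le (h : HasExpDichotomy M K μ) (hM : Continuous M) (hμ : 0 < μ) (hf : Continuous f)
    (hC : ∀ x, ‖f x‖ ≤ C) (hVB : ∀ x, ‖V x‖ ≤ B)
    (hV : ∀ x, HasDerivAt V (M x * V x + f x) x) (x : ℝ) : ‖V x‖ ≤ 2 * K / μ * C :=
  (h.norm_le_integral hM hμ hf hC hVB hV x).trans
    (h.mul_integral_exp_kernel_mul_norm_le hμ hf hC x)

theorem norm_le_weight (h : HasExpDichotomy M K μ) (hM : Continuous M) (hμ : 0 < μ)
    (hf : Continuous f) (hC : ∀ x, ‖f x‖ ≤ C) (hVB : ∀ x, ‖V x‖ ≤ B)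
    (hV : ∀ x, HasDerivAt V (M x * V x + f x) x) {w : ℝ → ℝ} {δ Λ q : ℝ} (hδ : 0 < δ)
    (hδw : ∀ y, δ ≤ w y) (hw : ∀ x, Integrable fun y => Real.exp (-μ * |x - y|) * w y)
    (hΛ : ∀ x, K * ∫ y, Real.exp (-μ * |x - y|) * w y ≤ Λ * w x) (hq : 0 ≤ q) (hΛq : Λ * q < 1)
    (hfw : ∀ y, ‖f y‖ ≤ q * ‖V y‖ + w y) (x : ℝ) : ‖V x‖ ≤ Λ / (1 - Λ * q) * w x := by
  have w_pos : ∀ y, 0 < w y := fun y => hδ.trans_le (hδw y)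
  -- `s` is the least constant with `‖V‖ ≤ s * w`; inserting that bound into the integral inequality
  -- gives `‖V‖ ≤ (q * s + 1) * Λ * w`, hence `s ≤ (q * s + 1) * Λ`.
  set s := ⨆ y, ‖V y‖ / w y
  have ratio_bddAbove : BddAbove (range fun y => ‖V y‖ / w y) := by
    refine ⟨B / δ, forall_mem_range.2 fun y => ?_⟩
    gcongr
    exacts [(norm_nonneg _).trans (hVB y), hVB y, hδw y]
  have norm_V_le : ∀ y, ‖V y‖ ≤ s * w y := fun y =>
    (div_le_iff₀ (w_pos y)).1 (le_ciSup ratio_bddAbove y)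
  have norm_f_le : ∀ y, ‖f y‖ ≤ (q * s + 1) * w y := fun y =>
    (hfw y).trans (by linarith [mul_le_mul_of_nonneg_left (norm_V_le y) hq])
  have s_nonneg : 0 ≤ s :=
    Real.iSup_nonneg fun y => div_nonneg (norm_nonneg _) (w_pos y).le
  have norm_V_le_improved : ∀ y, ‖V y‖ ≤ (q * s + 1) * Λ * w y := fun y => calc
    ‖V y‖ ≤ K * ∫ t, Real.exp (-μ * |y - t|) * ‖f t‖ := h.norm_le_integral hM hμ hf hC hVB hV y
    _ ≤ K * ∫ t, (q * s + 1) * (Real.exp (-μ * |y - t|) * w t) := by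
      refine mul_le_mul_of_nonneg_left (integral_mono
        (integrable_exp_kernel_mul_norm hμ hf hC y) ((hw y).const_mul _) fun t => ?_)
        h.nonneg
      exact (mul_le_mul_of_nonneg_left (norm_f_le t) (Real.exp_nonneg _)).trans_eq (by ring)
    _ = (q * s + 1) * (K * ∫ t, Real.exp (-μ * |y - t|) * w t) := by
      rw [integral_const_mul]; ring
    _ ≤ (q * s + 1) * (Λ * w y) := mul_le_mul_of_nonneg_left (hΛ y) (by positivity)
    _ = (q * s + 1) * Λ * w y := (mul_assoc _ _ _).symm
  have s_le : s ≤ (q * s + 1) * Λ :=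
    ciSup_le fun y => (div_le_iff₀ (w_pos y)).2 (norm_V_le_improved y)
  have s_le_gain : s ≤ Λ / (1 - Λ * q) := (le_div_iff₀ (sub_pos.2 hΛq)).2 (by linarith)
  exact (norm_V_le x).trans (mul_le_mul_of_nonneg_right s_le_gain (w_pos x).le)

theorem norm_le_local (h : HasExpDichotomy M K μ) (hM : Continuous M) (hμ : 0 < μ)
    (hf : Continuous f) (hVB : ∀ x, ‖V x‖ ≤ B) (hV : ∀ x, HasDerivAt V (M x * V x + f x) x)
    {a x c₁ c₂ q : ℝ} (hc₁ : 0 ≤ c₁) (hc₂ : 0 < c₂) (hq : 0 ≤ q) (hKq : 8 * K / μ * q ≤ 1)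
    (hlocal : ∀ y ∈ Icc (x - a) (x + a), ‖f y‖ ≤ q * ‖V y‖ + c₁)
    (hglobal : ∀ y, ‖f y‖ ≤ q * ‖V y‖ + c₂) :
    ‖V x‖ ≤ 4 * K / μ * (c₁ + 2 * c₂ * Real.exp (-a * μ / 2)) := by
  have hK := h.nonneg
  let d := 2 * c₂ * Real.exp (-(a * μ / 2))
  have rate_lt : |μ / 2| < μ := by rw [abs_of_pos] <;> linarith
  let w : ℝ → ℝ := fun y => c₁ + d * Real.cosh (μ / 2 * (y - x))
  have d_le_w : ∀ y, d ≤ w y := fun y =>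
    (le_mul_of_one_le_right (by positivity) (Real.one_le_cosh _)).trans
      (le_add_of_nonneg_left hc₁)
  have growth : ∀ y, ‖f y‖ ≤ q * ‖V y‖ + w y := fun y => by
    refine sub_le_iff_le_add'.1 (le_add_mul_cosh hc₁ hc₂.le (sub_le_iff_le_add'.2 (hglobal y))
      fun hy => sub_le_iff_le_add'.2 (hlocal y ?_))
    rw [abs_mul, abs_of_pos (half_pos hμ)] at hy
    rw [← mem_Icc_iff_abs_le, abs_sub_comm]
    nlinarith
  have kernel_bound : ∀ t, K * ∫ y, Real.exp (-μ * |t - y|) * w y ≤ 8 * K / (3 * μ) * w t :=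
    fun t => (mul_le_mul_of_nonneg_left
      (integral_exp_kernel_mul_add_cosh_le rate_lt hc₁ d x t) hK).trans_eq (by
        simp only [w]
        field_simp
        ring)
  have gain_mul_q_le : 8 * K / (3 * μ) * q ≤ 1 / 3 := by
    rw [mul_comm 3 μ, ← div_div]; linarith
  calc
    ‖V x‖ ≤ 8 * K / (3 * μ) / (1 - 8 * K / (3 * μ) * q) * w x :=
      h.norm_le_weight hM hμ hf (C := q * B + c₂)
        (fun y => (hglobal y).trans (by gcongr; exact hVB y)) hVB hV (by positivity)
        d_le_w (integrable_exp_kernel_mul_add_cosh rate_lt c₁ d x) kernel_bound hq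
        (by linarith) growth x
    _ ≤ 8 * K / (3 * μ) / (2 / 3) * w x := by
      gcongr
      linarith
    _ = 4 * K / μ * (c₁ + 2 * c₂ * Real.exp (-a * μ / 2)) := by
      simp only [w, d, sub_self, mul_zero, Real.cosh_zero, mul_one, neg_mul, neg_div]
      field_simp
      ring

end HasExpDichotomy

end Dichotomy

section Semilinear

/-- `V` solves `V' = F(x, V)` on all of `ℝ` and stays in the closed ball of radius `R` about the
origin: the class of functions in which the semilinear equations below are uniquely solvable. -/
def IsSolutionInBall {E : Type*} [NormedAddCommGroup E] [NormedSpace ℝ E] (F : ℝ → E → E) (R : ℝ)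
    (V : ℝ → E) : Prop :=
  (∀ x, ‖V x‖ ≤ R) ∧ ∀ x, HasDerivAt V (F x (V x)) x

theorem IsSolutionInBall.continuous {E : Type*} [NormedAddCommGroup E] [NormedSpace ℝ E]
    {F : ℝ → E → E} {R : ℝ} {V : ℝ → E} (hV : IsSolutionInBall F R V) : Continuous V :=
  continuous_iff_continuousAt.2 fun x => (hV.2 x).continuousAt

theorem IsSolutionInBall.periodic {E : Type*} [NormedAddCommGroup E] [NormedSpace ℝ E]
    {F : ℝ → E → E} {R L : ℝ} {V : ℝ → E} (hV : IsSolutionInBall F R V)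
    (unique : ∃! W, IsSolutionInBall F R W) (hF : ∀ x v, F (x + L) v = F x v) :
    Function.Periodic V L := by
  have translate_isSolution : IsSolutionInBall F R fun x => V (x + L) :=
    ⟨fun x => hV.1 (x + L), fun x => by simpa only [hF] using (hV.2 (x + L)).comp_add_const x L⟩
  exact congrFun (unique.unique translate_isSolution hV)

theorem norm_apply_le_of_mem_closedBall {α E : Type*} [TopologicalSpace α] [NormedAddCommGroup E]
    {f : α →ᵇ E} {R : ℝ} (hf : f ∈ Metric.closedBall 0 R) (x : α) : ‖f x‖ ≤ R :=
  (f.norm_coe_le_norm x).trans (mem_closedBall_zero_iff.1 hf)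

theorem ofNormedAddCommGroup_mem_closedBall {α E : Type*} [TopologicalSpace α]
    [NormedAddCommGroup E] {f : α → E} {R : ℝ} (hf : Continuous f) (hR : 0 ≤ R)
    (hfR : ∀ x, ‖f x‖ ≤ R) :
    BoundedContinuousFunction.ofNormedAddCommGroup f hf R hfR ∈ Metric.closedBall 0 R :=
  mem_closedBall_zero_iff.2 (BoundedContinuousFunction.norm_ofNormedAddCommGroup_le hf hR hfR)

attribute [local instance] realNormedSpace

variable {n : ℕ} {κ : Type*} [Fintype κ] [DecidableEq κ] {M : ℝ → Matrix (Fin n) (Fin n) ℂ}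
  {N : ℝ → Matrix (Fin n) κ ℂ → Matrix (Fin n) κ ℂ} {K μ q C c R : ℝ}

namespace HasExpDichotomy

theorem exists_picard_iterate (h : HasExpDichotomy M K μ) (hM : Continuous M) (hμ : 0 < μ)
    (hN : Continuous (Function.uncurry N)) (hNC : ∀ x v, ‖v‖ ≤ R → ‖N x v‖ ≤ C)
    (hCR : 2 * K / μ * C ≤ R) {V : ℝ → Matrix (Fin n) κ ℂ} (hV : Continuous V)
    (hVR : ∀ x, ‖V x‖ ≤ R) :
    ∃ W : ℝ → Matrix (Fin n) κ ℂ, (∀ x, ‖W x‖ ≤ R) ∧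
      ∀ x, HasDerivAt W (M x * W x + N x (V x)) x := by
  have forcing_continuous : Continuous fun x => N x (V x) := hN.comp (continuous_id.prodMk hV)
  have forcing_bounded : ∀ x, ‖N x (V x)‖ ≤ C := fun x => hNC x (V x) (hVR x)
  obtain ⟨W, norm_W_le, hW⟩ := h.exists_bounded_solution hM hμ forcing_continuous forcing_bounded
  exact ⟨W, fun x => (norm_W_le x).trans ((h.mul_integral_exp_kernel_mul_norm_le hμ
    forcing_continuous forcing_bounded x).trans hCR), hW⟩

theorem norm_picard_iterate_sub_le (h : HasExpDichotomy M K μ) (hM : Continuous M) (hμ : 0 < μ)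
    (hN : Continuous (Function.uncurry N)) (hq : 0 ≤ q)
    (hlip : ∀ x v w, ‖v‖ ≤ R → ‖w‖ ≤ R → ‖N x v - N x w‖ ≤ q * ‖v - w‖)
    {V₁ V₂ W₁ W₂ : ℝ → Matrix (Fin n) κ ℂ} (hV₁ : Continuous V₁) (hV₂ : Continuous V₂)
    (hV₁R : ∀ x, ‖V₁ x‖ ≤ R) (hV₂R : ∀ x, ‖V₂ x‖ ≤ R) (hW₁R : ∀ x, ‖W₁ x‖ ≤ R)
    (hW₂R : ∀ x, ‖W₂ x‖ ≤ R) (hW₁ : ∀ x, HasDerivAt W₁ (M x * W₁ x + N x (V₁ x)) x)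
    (hW₂ : ∀ x, HasDerivAt W₂ (M x * W₂ x + N x (V₂ x)) x) {d : ℝ}
    (hd : ∀ x, ‖V₁ x - V₂ x‖ ≤ d) (x : ℝ) : ‖W₁ x - W₂ x‖ ≤ 2 * K / μ * q * d := by
  rw [mul_assoc]
  refine h.norm_le hM hμ (V := fun x => W₁ x - W₂ x) (f := fun x => N x (V₁ x) - N x (V₂ x))
    ((hN.comp (continuous_id.prodMk hV₁)).sub (hN.comp (continuous_id.prodMk hV₂)))
    (fun y => (hlip y _ _ (hV₁R y) (hV₂R y)).trans (mul_le_mul_of_nonneg_left (hd y) hq))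
    (fun y => norm_sub_le_of_le (hW₁R y) (hW₂R y)) (fun y => ?_) x
  rw [Matrix.mul_sub, ← add_sub_add_comm]
  exact (hW₁ y).sub (hW₂ y)

theorem exists_contractingWith_picard (h : HasExpDichotomy M K μ) (hM : Continuous M)
    (hμ : 0 < μ) (hN : Continuous (Function.uncurry N)) (hR : 0 ≤ R)
    (hNC : ∀ x v, ‖v‖ ≤ R → ‖N x v‖ ≤ C) (hCR : 2 * K / μ * C ≤ R) (hq : 0 ≤ q)
    (hKq : 2 * K / μ * q < 1)
    (hlip : ∀ x v w, ‖v‖ ≤ R → ‖w‖ ≤ R → ‖N x v - N x w‖ ≤ q * ‖v - w‖) :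
    ∃ (k : NNReal) (Γ : Metric.closedBall (0 : ℝ →ᵇ Matrix (Fin n) κ ℂ) R →
        Metric.closedBall (0 : ℝ →ᵇ Matrix (Fin n) κ ℂ) R), ContractingWith k Γ ∧
      ∀ V x, HasDerivAt (Γ V).1 (M x * (Γ V).1 x + N x (V.1 x)) x := by
  have picard (V : Metric.closedBall (0 : ℝ →ᵇ Matrix (Fin n) κ ℂ) R) :
      ∃ W : Metric.closedBall (0 : ℝ →ᵇ Matrix (Fin n) κ ℂ) R,
        ∀ x, HasDerivAt W.1 (M x * W.1 x + N x (V.1 x)) x :=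
    let ⟨W, hWR, hW⟩ := h.exists_picard_iterate hM hμ hN hNC hCR V.1.continuous
      (norm_apply_le_of_mem_closedBall V.2)
    ⟨⟨.ofNormedAddCommGroup W (continuous_iff_continuousAt.2 fun x => (hW x).continuousAt) R hWR,
      ofNormedAddCommGroup_mem_closedBall _ hR hWR⟩, hW⟩
  choose Γ hΓ using picard
  have rate_nonneg : 0 ≤ 2 * K / μ * q := by have := h.nonneg; positivity
  refine ⟨⟨2 * K / μ * q, rate_nonneg⟩, Γ, ⟨hKq, LipschitzWith.of_dist_le_mul fun V W => ?_⟩, hΓ⟩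
  rw [Subtype.dist_eq, Subtype.dist_eq, dist_eq_norm, dist_eq_norm]
  exact (BoundedContinuousFunction.norm_le (mul_nonneg rate_nonneg (norm_nonneg _))).2
    (h.norm_picard_iterate_sub_le hM hμ hN hq hlip V.1.continuous W.1.continuous
      (norm_apply_le_of_mem_closedBall V.2) (norm_apply_le_of_mem_closedBall W.2)
      (norm_apply_le_of_mem_closedBall (Γ V).2) (norm_apply_le_of_mem_closedBall (Γ W).2)
      (hΓ V) (hΓ W) (V.1 - W.1).norm_coe_le_norm)

theorem existsUnique_isSolutionInBall (h : HasExpDichotomy M K μ) (hM : Continuous M)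
    (hμ : 0 < μ) (hN : Continuous (Function.uncurry N)) (hq : 0 ≤ q) (hKq : 2 * K / μ * q < 1)
    (hlip : ∀ x v w, ‖v‖ ≤ R → ‖w‖ ≤ R → ‖N x v - N x w‖ ≤ q * ‖v - w‖)
    (hc : ∀ x, ‖N x 0‖ ≤ c) (hR : 2 * K / μ * (q * R + c) ≤ R) :
    ∃! V, IsSolutionInBall (fun x v => M x * v + N x v) R V := by
  have R_nonneg : 0 ≤ R := by
    have gain_nonneg : 0 ≤ 2 * K / μ := by have := h.nonneg; positivity
    nlinarith [mul_nonneg gain_nonneg ((norm_nonneg _).trans (hc 0))]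
  have norm_N_le : ∀ x v, ‖v‖ ≤ R → ‖N x v‖ ≤ q * R + c := fun x v hv => calc
    ‖N x v‖ ≤ ‖N x v - N x 0‖ + ‖N x 0‖ := norm_le_norm_sub_add _ _
    _ ≤ q * ‖v - 0‖ + c := add_le_add (hlip x v 0 hv (norm_zero.trans_le R_nonneg)) (hc x)
    _ ≤ q * R + c := by rw [sub_zero]; gcongr
  obtain ⟨k, Γ, contracting, hΓ⟩ :=
    h.exists_contractingWith_picard hM hμ hN R_nonneg norm_N_le hR hq hKq hlip
  have : Nonempty (Metric.closedBall (0 : ℝ →ᵇ Matrix (Fin n) κ ℂ) R) :=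
    (Metric.nonempty_closedBall.2 R_nonneg).to_subtype
  have : CompleteSpace (Metric.closedBall (0 : ℝ →ᵇ Matrix (Fin n) κ ℂ) R) :=
    Metric.isClosed_closedBall.completeSpace_coe
  refine ⟨(contracting.fixedPoint Γ).1,
    ⟨norm_apply_le_of_mem_closedBall (Subtype.prop _), fun x => ?_⟩, ?_⟩
  · have derivative := hΓ (contracting.fixedPoint Γ) x
    rwa [contracting.fixedPoint_isFixedPt.eq] at derivative
  · rintro V ⟨hVR, hV⟩
    let v : Metric.closedBall (0 : ℝ →ᵇ Matrix (Fin n) κ ℂ) R :=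
      ⟨.ofNormedAddCommGroup V (continuous_iff_continuousAt.2 fun x => (hV x).continuousAt) R hVR,
        ofNormedAddCommGroup_mem_closedBall _ R_nonneg hVR⟩
    have v_isFixedPt : Γ v = v := Subtype.ext (DFunLike.coe_injective
      (h.eq_of_bounded hM hμ (norm_apply_le_of_mem_closedBall (Γ v).2) hVR (hΓ v) hV))
    exact congrArg (fun W : Metric.closedBall (0 : ℝ →ᵇ Matrix (Fin n) κ ℂ) R => ⇑W.1)
      (contracting.fixedPoint_unique v_isFixedPt)

theorem existsUnique_isSolutionInBall_of_small (h : HasExpDichotomy M K μ) (hM : Continuous M)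
    (hμ : 0 < μ) (hN : Continuous (Function.uncurry N)) (hq : 0 ≤ q) (hKq : 8 * K / μ * q ≤ 1)
    (hlip : ∀ x v w, ‖v‖ ≤ 8 * K * μ⁻¹ * c → ‖w‖ ≤ 8 * K * μ⁻¹ * c →
      ‖N x v - N x w‖ ≤ q * ‖v - w‖)
    (hc : ∀ x, ‖N x 0‖ ≤ c) :
    ∃! V, IsSolutionInBall (fun x v => M x * v + N x v) (8 * K * μ⁻¹ * c) V := by
  have hK := h.nonneg
  have c_nonneg : 0 ≤ c := (norm_nonneg _).trans (hc 0)
  have rate_le : 2 * K / μ * q ≤ 1 / 4 := by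
    linarith [show 8 * K / μ * q = 4 * (2 * K / μ * q) by ring]
  refine h.existsUnique_isSolutionInBall hM hμ hN hq (rate_le.trans_lt (by norm_num)) hlip hc ?_
  calc
    2 * K / μ * (q * (8 * K * μ⁻¹ * c) + c)
        = 2 * K / μ * q * (8 * K * μ⁻¹ * c) + 1 / 4 * (8 * K * μ⁻¹ * c) := by ring
    _ ≤ 1 / 4 * (8 * K * μ⁻¹ * c) + 1 / 4 * (8 * K * μ⁻¹ * c) := by gcongr
    _ ≤ 8 * K * μ⁻¹ * c := by
      linarith [show 0 ≤ 8 * K * μ⁻¹ * c by positivity]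

end HasExpDichotomy

end Semilinear

section BlockDiagonalization

theorem transforms_of_hasDerivAt {ι : Type} [Fintype ι] [DecidableEq ι]
    {H G G' M N : ℝ → Matrix ι ι ℂ} (hGH : ∀ x, G x * H x = 1)
    (hH : ∀ x, HasDerivAt H (M x * H x - H x * N x) x) (hG : ∀ x, HasDerivAt G (G' x) x) :
    Transforms H M N := by
  have hasDerivAt_mulVec {w : ℝ → ι → ℂ} {w' : ι → ℂ} {x : ℝ} (hw : HasDerivAt w w' x) :
      HasDerivAt (fun x => H x *ᵥ w x) (M x *ᵥ (H x *ᵥ w x) + H x *ᵥ (w' - N x *ᵥ w x)) x := by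
    convert hasDerivAt_matrix_mulVec (hH x) hw using 1
    rw [Matrix.sub_mulVec, Matrix.mulVec_sub, Matrix.mulVec_mulVec, Matrix.mulVec_mulVec]
    abel
  have mulVec_cancel (x : ℝ) (v : ι → ℂ) : G x *ᵥ (H x *ᵥ v) = v := by
    rw [Matrix.mulVec_mulVec, hGH, Matrix.one_mulVec]
  refine ⟨fun x => IsUnit.of_mul_eq_one_right _ (hGH x), fun w => ⟨fun hw x => ?_, fun hz x => ?_⟩⟩
  · simpa only [sub_self, Matrix.mulVec_zero, add_zero] using hasDerivAt_mulVec (hw x)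
  · obtain ⟨w', hw⟩ : ∃ w', HasDerivAt w w' x :=
      ⟨_, by simpa only [mulVec_cancel] using hasDerivAt_matrix_mulVec (hG x) (hz x)⟩
    have mulVec_defect : H x *ᵥ (w' - N x *ᵥ w x) = 0 :=
      add_eq_left.1 ((hasDerivAt_mulVec hw).unique (hz x))
    have defect : w' - N x *ᵥ w x = 0 := by
      rw [← mulVec_cancel x (w' - N x *ᵥ w x), mulVec_defect, Matrix.mulVec_zero]
    rwa [← sub_eq_zero.1 defect]

variable {n₁ n₂ : ℕ} {ε : ℝ}
  {A₁₁ : ℝ → Matrix (Fin n₁) (Fin n₁) ℂ} {A₁₂ : ℝ → Matrix (Fin n₁) (Fin n₂) ℂ}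
  {A₂₁ : ℝ → Matrix (Fin n₂) (Fin n₁) ℂ} {A₂₂ : ℝ → Matrix (Fin n₂) (Fin n₂) ℂ}
  {U : ℝ → Matrix (Fin n₂) (Fin n₁) ℂ} {S : ℝ → Matrix (Fin n₁) (Fin n₂) ℂ}

theorem fromBlocks_mul_riccatiTransform (ε : ℝ) (U : ℝ → Matrix (Fin n₂) (Fin n₁) ℂ)
    (S : ℝ → Matrix (Fin n₁) (Fin n₂) ℂ) (x : ℝ) :
    Matrix.fromBlocks (1 - (ε : ℂ) • (S x * U x)) ((ε : ℂ) • S x) (-U x) 1 *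
      riccatiTransform ε U S x = 1 := by
  rw [riccatiTransform, Matrix.fromBlocks_multiply, ← Matrix.fromBlocks_one]
  congr 1
  · simp
  · simp only [Matrix.sub_mul, Matrix.mul_sub, Matrix.one_mul, Matrix.mul_one, Matrix.mul_neg,
      Matrix.mul_smul, Matrix.smul_mul, Matrix.mul_assoc]
    module
  · simp
  · simp

namespace IsRiccatiPair

theorem hasDerivAt_riccatiTransform (h : IsRiccatiPair ε A₁₁ A₁₂ A₂₁ A₂₂ U S) (x : ℝ) :
    HasDerivAt (riccatiTransform ε U S)
      (coupled ε A₁₁ A₁₂ A₂₁ A₂₂ x * riccatiTransform ε U S x -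
        riccatiTransform ε U S x * decoupled ε A₁₁ A₁₂ A₂₂ U x) x := by
  obtain ⟨-, -, hU, hS⟩ := h
  have blockwise := hasDerivAt_matrix_fromBlocks
    (hasDerivAt_const x (1 : Matrix (Fin n₁) (Fin n₁) ℂ)) ((hS x).const_smul (ε : ℂ)).neg (hU x)
    (((hasDerivAt_matrix_mul (hU x) (hS x)).const_smul (ε : ℂ)).const_sub 1)
  convert blockwise using 1
  · rfl
  rw [sub_eq_iff_eq_add, riccatiTransform, coupled, decoupled, Matrix.fromBlocks_multiply,
    Matrix.fromBlocks_multiply, Matrix.fromBlocks_add]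
  simp only [Matrix.sub_mul, Matrix.mul_sub, Matrix.one_mul, Matrix.mul_one, Matrix.mul_neg,
    Matrix.neg_mul, Matrix.add_mul, Matrix.mul_add, Matrix.mul_zero,
    Matrix.mul_smul, Matrix.smul_mul, Matrix.mul_assoc, smul_add, smul_sub]
  congr 1 <;> module

theorem transforms (h : IsRiccatiPair ε A₁₁ A₁₂ A₂₁ A₂₂ U S) :
    Transforms (riccatiTransform ε U S) (coupled ε A₁₁ A₁₂ A₂₁ A₂₂)
      (decoupled ε A₁₁ A₁₂ A₂₂ U) :=
  transforms_of_hasDerivAt (fromBlocks_mul_riccatiTransform ε U S) h.hasDerivAt_riccatiTransform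
    fun x => hasDerivAt_matrix_fromBlocks
      (((hasDerivAt_matrix_mul (h.2.2.2 x) (h.2.2.1 x)).const_smul (ε : ℂ)).const_sub 1)
      ((h.2.2.2 x).const_smul (ε : ℂ)) (h.2.2.1 x).neg (hasDerivAt_const x 1)

end IsRiccatiPair

end BlockDiagonalization

section Riccati

attribute [local instance] realNormedSpace

variable {n₁ n₂ : ℕ}

/-- The right-hand side of the Riccati equation for `U` without its linear term `A₂₂ U`, so that
the equation reads `U' = A₂₂ U + riccatiForcing U`. -/
noncomputable def riccatiForcing (ε : ℝ) (A₁₁ : ℝ → Matrix (Fin n₁) (Fin n₁) ℂ)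
    (A₁₂ : ℝ → Matrix (Fin n₁) (Fin n₂) ℂ) (A₂₁ : ℝ → Matrix (Fin n₂) (Fin n₁) ℂ)
    (x : ℝ) (u : Matrix (Fin n₂) (Fin n₁) ℂ) : Matrix (Fin n₂) (Fin n₁) ℂ :=
  A₂₁ x - (ε : ℂ) • (u * A₁₁ x) - (ε : ℂ) • (u * A₁₂ x * u)

/-- The right-hand side of the equation satisfied by `Z = Sᴴ` without its linear term `-A₂₂ᴴ Z`.
Passing to `Sᴴ` moves the unknown to the right of `A₂₂`, where the adjoint dichotomy applies. -/
noncomputable def adjointForcing (ε : ℝ) (A₁₁ : ℝ → Matrix (Fin n₁) (Fin n₁) ℂ)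
    (A₁₂ : ℝ → Matrix (Fin n₁) (Fin n₂) ℂ) (U : ℝ → Matrix (Fin n₂) (Fin n₁) ℂ)
    (x : ℝ) (z : Matrix (Fin n₂) (Fin n₁) ℂ) : Matrix (Fin n₂) (Fin n₁) ℂ :=
  (ε : ℂ) • (z * (A₁₁ x + A₁₂ x * U x)ᴴ) + (ε : ℂ) • ((U x * A₁₂ x)ᴴ * z) - (A₁₂ x)ᴴ

variable {ε a₁₁ a₁₂ a₂₁ K μ R : ℝ}
  {A₁₁ : ℝ → Matrix (Fin n₁) (Fin n₁) ℂ} {A₁₂ : ℝ → Matrix (Fin n₁) (Fin n₂) ℂ}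
  {A₂₁ : ℝ → Matrix (Fin n₂) (Fin n₁) ℂ} {A₂₂ : ℝ → Matrix (Fin n₂) (Fin n₂) ℂ}
  {U Z Ω : ℝ → Matrix (Fin n₂) (Fin n₁) ℂ}

theorem continuous_riccatiForcing (ε : ℝ) (c₁₁ : Continuous A₁₁) (c₁₂ : Continuous A₁₂)
    (c₂₁ : Continuous A₂₁) : Continuous (Function.uncurry (riccatiForcing ε A₁₁ A₁₂ A₂₁)) :=
  ((c₂₁.comp continuous_fst).sub
    ((continuous_snd.matrix_mul (c₁₁.comp continuous_fst)).const_smul (ε : ℂ))).sub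
    (((continuous_snd.matrix_mul (c₁₂.comp continuous_fst)).matrix_mul
      continuous_snd).const_smul (ε : ℂ))

theorem continuous_adjointForcing (ε : ℝ) (c₁₁ : Continuous A₁₁) (c₁₂ : Continuous A₁₂)
    (cU : Continuous U) : Continuous (Function.uncurry (adjointForcing ε A₁₁ A₁₂ U)) :=
  (((continuous_snd.matrix_mul
    ((c₁₁.add (c₁₂.matrix_mul cU)).matrix_conjTranspose.comp continuous_fst)).const_smul
      (ε : ℂ)).add
    ((((cU.matrix_mul c₁₂).matrix_conjTranspose.comp continuous_fst).matrix_mul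
      continuous_snd).const_smul (ε : ℂ))).sub (c₁₂.matrix_conjTranspose.comp continuous_fst)

theorem norm_riccatiForcing_sub_riccatiForcing_le (hε : 0 ≤ ε) (h₁₁ : ∀ x, ‖A₁₁ x‖ ≤ a₁₁)
    (h₁₂ : ∀ x, ‖A₁₂ x‖ ≤ a₁₂) (x : ℝ) (v w : Matrix (Fin n₂) (Fin n₁) ℂ) (hv : ‖v‖ ≤ R)
    (hw : ‖w‖ ≤ R) :
    ‖riccatiForcing ε A₁₁ A₁₂ A₂₁ x v - riccatiForcing ε A₁₁ A₁₂ A₂₁ x w‖ ≤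
      ε * (a₁₁ + 2 * R * a₁₂) * ‖v - w‖ := by
  have difference : riccatiForcing ε A₁₁ A₁₂ A₂₁ x v - riccatiForcing ε A₁₁ A₁₂ A₂₁ x w =
      (ε : ℂ) • ((w - v) * A₁₁ x + (w - v) * A₁₂ x * v + w * A₁₂ x * (w - v)) := by
    simp only [riccatiForcing, Matrix.sub_mul, Matrix.mul_sub]
    module
  have norm_swap_le : ‖w - v‖ ≤ ‖v - w‖ := (norm_sub_rev w v).le
  rw [difference]
  exact (norm_ofReal_smul_le hε (norm_add₃_le.trans (add_le_add_three
    (norm_mul_le_of_le norm_swap_le (h₁₁ x))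
    (norm_mul_le_of_le (norm_mul_le_of_le norm_swap_le (h₁₂ x)) hv)
    (norm_mul_le_of_le (norm_mul_le_of_le hw (h₁₂ x)) norm_swap_le)))).trans_eq (by ring)

theorem norm_adjointForcing_sub_adjointForcing_le (hε : 0 ≤ ε) (h₁₁ : ∀ x, ‖A₁₁ x‖ ≤ a₁₁)
    (h₁₂ : ∀ x, ‖A₁₂ x‖ ≤ a₁₂) (hU : ∀ x, ‖U x‖ ≤ R) (x : ℝ)
    (v w : Matrix (Fin n₂) (Fin n₁) ℂ) :
    ‖adjointForcing ε A₁₁ A₁₂ U x v - adjointForcing ε A₁₁ A₁₂ U x w‖ ≤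
      ε * (a₁₁ + 2 * R * a₁₂) * ‖v - w‖ := by
  have difference : adjointForcing ε A₁₁ A₁₂ U x v - adjointForcing ε A₁₁ A₁₂ U x w =
      (ε : ℂ) • ((v - w) * (A₁₁ x + A₁₂ x * U x)ᴴ + (U x * A₁₂ x)ᴴ * (v - w)) := by
    simp only [adjointForcing, Matrix.sub_mul, Matrix.mul_sub]
    module
  have norm_slow_le : ‖(A₁₁ x + A₁₂ x * U x)ᴴ‖ ≤ a₁₁ + a₁₂ * R := by
    rw [Matrix.l2_opNorm_conjTranspose]
    exact norm_add_le_of_le (h₁₁ x) (norm_mul_le_of_le (h₁₂ x) (hU x))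
  have norm_fast_le : ‖(U x * A₁₂ x)ᴴ‖ ≤ R * a₁₂ := by
    rw [Matrix.l2_opNorm_conjTranspose]
    exact norm_mul_le_of_le (hU x) (h₁₂ x)
  rw [difference]
  exact (norm_ofReal_smul_le hε (norm_add_le_of_le (norm_mul_le_of_le le_rfl norm_slow_le)
    (norm_mul_le_of_le norm_fast_le le_rfl))).trans_eq (by ring)

theorem norm_riccatiForcing_sub_le (hε : 0 ≤ ε) (h₁₁ : ∀ x, ‖A₁₁ x‖ ≤ a₁₁)
    (h₁₂ : ∀ x, ‖A₁₂ x‖ ≤ a₁₂) (x : ℝ) (v : Matrix (Fin n₂) (Fin n₁) ℂ) :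
    ‖riccatiForcing ε A₁₁ A₁₂ A₂₁ x v - A₂₁ x‖ ≤ ε * (a₁₁ * ‖v‖ + a₁₂ * ‖v‖ ^ 2) := by
  have difference : riccatiForcing ε A₁₁ A₁₂ A₂₁ x v - A₂₁ x =
      -((ε : ℂ) • (v * A₁₁ x + v * A₁₂ x * v)) := by
    rw [riccatiForcing]
    module
  rw [difference, norm_neg]
  exact (norm_ofReal_smul_le hε (norm_add_le_of_le (norm_mul_le_of_le le_rfl (h₁₁ x))
    (norm_mul_le_of_le (norm_mul_le_of_le le_rfl (h₁₂ x)) le_rfl))).trans_eq (by ring)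

theorem norm_riccatiForcing_le (hε : 0 ≤ ε) (h₁₁ : ∀ x, ‖A₁₁ x‖ ≤ a₁₁)
    (h₁₂ : ∀ x, ‖A₁₂ x‖ ≤ a₁₂) (x : ℝ) (v : Matrix (Fin n₂) (Fin n₁) ℂ) :
    ‖riccatiForcing ε A₁₁ A₁₂ A₂₁ x v‖ ≤
      ε * a₁₁ * ‖v‖ + (ε * a₁₂ * ‖v‖ ^ 2 + ‖A₂₁ x‖) := by
  linarith [norm_riccatiForcing_sub_le (A₂₁ := A₂₁) hε h₁₁ h₁₂ x v,
    norm_le_norm_sub_add (riccatiForcing ε A₁₁ A₁₂ A₂₁ x v) (A₂₁ x)]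

theorem mul_le_one_of_lt_one_div {q : ℝ} (hε : 0 ≤ ε) (hεq : ε < 1 / (|q| + 1)) : ε * q ≤ 1 :=
  calc
    ε * q ≤ ε * (|q| + 1) := by gcongr; exact (le_abs_self q).trans (lt_add_one _).le
    _ ≤ 1 := ((lt_div_iff₀ (by positivity)).1 hεq).le

theorem forcing_le_two_mul_of_small (hK : 0 ≤ K) (hμ : 0 < μ) (hε : 0 ≤ ε) (h₁₁ : 0 ≤ a₁₁)
    (h₁₂ : 0 ≤ a₁₂) (h₂₁ : ∀ x, ‖A₂₁ x‖ ≤ a₂₁) (hU : ∀ x, ‖U x‖ ≤ 8 * K * μ⁻¹ * a₂₁)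
    (hsmall : 8 * K / μ * (ε * (a₁₁ + 2 * (8 * K * μ⁻¹ * a₂₁) * a₁₂)) ≤ 1) (x : ℝ) :
    ε * a₁₂ * ‖U x‖ ^ 2 + ‖A₂₁ x‖ ≤ 2 * a₂₁ := by
  have a₂₁_nonneg : 0 ≤ a₂₁ := (norm_nonneg _).trans (h₂₁ x)
  have quadratic_le : ε * a₁₂ * ‖U x‖ ^ 2 ≤ a₂₁ := calc
    ε * a₁₂ * ‖U x‖ ^ 2 ≤ ε * a₁₂ * (8 * K * μ⁻¹ * a₂₁) ^ 2 := by gcongr; exact hU x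
    _ = 8 * K / μ * (ε * (8 * K * μ⁻¹ * a₂₁ * a₁₂)) * a₂₁ := by ring
    _ ≤ 8 * K / μ * (ε * (a₁₁ + 2 * (8 * K * μ⁻¹ * a₂₁) * a₁₂)) * a₂₁ := by
      gcongr
      linarith [show 0 ≤ 8 * K * μ⁻¹ * a₂₁ * a₁₂ by positivity]
    _ ≤ a₂₁ := mul_le_of_le_one_left a₂₁_nonneg hsmall
  linarith [h₂₁ x]

namespace HasExpDichotomy

theorem existsUnique_riccati (h : HasExpDichotomy A₂₂ K μ) (hμ : 0 < μ) (hε : 0 ≤ ε)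
    (c₁₁ : Continuous A₁₁) (c₁₂ : Continuous A₁₂) (c₂₁ : Continuous A₂₁) (c₂₂ : Continuous A₂₂)
    (h₁₁ : ∀ x, ‖A₁₁ x‖ ≤ a₁₁) (h₁₂ : ∀ x, ‖A₁₂ x‖ ≤ a₁₂) (h₂₁ : ∀ x, ‖A₂₁ x‖ ≤ a₂₁)
    (hsmall : 8 * K / μ * (ε * (a₁₁ + 2 * (8 * K * μ⁻¹ * a₂₁) * a₁₂)) ≤ 1) :
    ∃! U, IsSolutionInBall (fun x u => A₂₂ x * u + riccatiForcing ε A₁₁ A₁₂ A₂₁ x u)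
      (8 * K * μ⁻¹ * a₂₁) U := by
  have := h.nonneg
  have a₁₁_nonneg : 0 ≤ a₁₁ := (norm_nonneg _).trans (h₁₁ 0)
  have a₁₂_nonneg : 0 ≤ a₁₂ := (norm_nonneg _).trans (h₁₂ 0)
  have a₂₁_nonneg : 0 ≤ a₂₁ := (norm_nonneg _).trans (h₂₁ 0)
  exact h.existsUnique_isSolutionInBall_of_small c₂₂ hμ
    (continuous_riccatiForcing ε c₁₁ c₁₂ c₂₁) (by positivity) hsmall
    (norm_riccatiForcing_sub_riccatiForcing_le hε h₁₁ h₁₂)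
    fun x => by simpa [riccatiForcing] using h₂₁ x

theorem existsUnique_adjointRiccati (h : HasExpDichotomy A₂₂ K μ) (hμ : 0 < μ) (hε : 0 ≤ ε)
    (c₁₁ : Continuous A₁₁) (c₁₂ : Continuous A₁₂) (c₂₂ : Continuous A₂₂) (cU : Continuous U)
    (h₁₁ : ∀ x, ‖A₁₁ x‖ ≤ a₁₁) (h₁₂ : ∀ x, ‖A₁₂ x‖ ≤ a₁₂) (hU : ∀ x, ‖U x‖ ≤ R)
    (hsmall : 8 * K / μ * (ε * (a₁₁ + 2 * R * a₁₂)) ≤ 1) :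
    ∃! Z, IsSolutionInBall (fun x z => -(A₂₂ x)ᴴ * z + adjointForcing ε A₁₁ A₁₂ U x z)
      (8 * K * μ⁻¹ * a₁₂) Z := by
  have a₁₁_nonneg : 0 ≤ a₁₁ := (norm_nonneg _).trans (h₁₁ 0)
  have a₁₂_nonneg : 0 ≤ a₁₂ := (norm_nonneg _).trans (h₁₂ 0)
  have R_nonneg : 0 ≤ R := (norm_nonneg _).trans (hU 0)
  exact (h.adjoint c₂₂).existsUnique_isSolutionInBall_of_small c₂₂.matrix_conjTranspose.neg hμ
    (continuous_adjointForcing ε c₁₁ c₁₂ cU) (by positivity) hsmall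
    (fun x v w _ _ => norm_adjointForcing_sub_adjointForcing_le hε h₁₁ h₁₂ hU x v w)
    fun x => by simpa [adjointForcing, Matrix.l2_opNorm_conjTranspose] using h₁₂ x

theorem existsUnique_isBoundedInhomSolution (h : HasExpDichotomy A₂₂ K μ) (hμ : 0 < μ)
    (c₂₁ : Continuous A₂₁) (c₂₂ : Continuous A₂₂) (h₂₁ : ∀ x, ‖A₂₁ x‖ ≤ a₂₁) :
    ∃! Ω, IsBoundedInhomSolution A₂₁ A₂₂ Ω := by
  obtain ⟨Ω, norm_Ω_le, hΩ⟩ := h.exists_bounded_solution c₂₂ hμ c₂₁ h₂₁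
  have norm_Ω_le_const : ∀ x, ‖Ω x‖ ≤ 2 * K / μ * a₂₁ := fun x =>
    (norm_Ω_le x).trans (h.mul_integral_exp_kernel_mul_norm_le hμ c₂₁ h₂₁ x)
  exact ⟨Ω, ⟨⟨_, norm_Ω_le_const⟩, hΩ⟩, fun Ω' ⟨⟨_, norm_Ω'_le⟩, hΩ'⟩ =>
    h.eq_of_bounded c₂₂ hμ norm_Ω'_le norm_Ω_le_const hΩ' hΩ⟩

theorem norm_riccati_sub_inhomSolution_le (h : HasExpDichotomy A₂₂ K μ) (hμ : 0 < μ)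
    (hε : 0 ≤ ε) (c₁₁ : Continuous A₁₁) (c₁₂ : Continuous A₁₂) (c₂₁ : Continuous A₂₁)
    (c₂₂ : Continuous A₂₂) (h₁₁ : ∀ x, ‖A₁₁ x‖ ≤ a₁₁) (h₁₂ : ∀ x, ‖A₁₂ x‖ ≤ a₁₂)
    (hU : IsSolutionInBall (fun x u => A₂₂ x * u + riccatiForcing ε A₁₁ A₁₂ A₂₁ x u) R U)
    (hΩ : IsBoundedInhomSolution A₂₁ A₂₂ Ω) (x : ℝ) :
    ‖U x - Ω x‖ ≤ 2 * K / μ * (a₁₁ * R + a₁₂ * R ^ 2) * ε := by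
  obtain ⟨⟨B, norm_Ω_le⟩, hΩ⟩ := hΩ
  have a₁₁_nonneg : 0 ≤ a₁₁ := (norm_nonneg _).trans (h₁₁ 0)
  have a₁₂_nonneg : 0 ≤ a₁₂ := (norm_nonneg _).trans (h₁₂ 0)
  rw [mul_assoc, mul_comm _ ε]
  refine h.norm_le c₂₂ hμ (V := fun x => U x - Ω x)
    (f := fun x => riccatiForcing ε A₁₁ A₁₂ A₂₁ x (U x) - A₂₁ x)
    (((continuous_riccatiForcing ε c₁₁ c₁₂ c₂₁).comp (continuous_id.prodMk hU.continuous)).sub c₂₁)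
    (fun y => (norm_riccatiForcing_sub_le hε h₁₁ h₁₂ y (U y)).trans ?_)
    (fun y => norm_sub_le_of_le (hU.1 y) (norm_Ω_le y)) (fun y => ?_) x
  · gcongr <;> exact hU.1 y
  · rw [Matrix.mul_sub, ← add_sub_add_comm]
    exact (hU.2 y).sub (hΩ y)

theorem norm_riccati_le_iSup (h : HasExpDichotomy A₂₂ K μ) (hμ : 0 < μ)
    (hε : 0 ≤ ε) (c₁₁ : Continuous A₁₁) (c₁₂ : Continuous A₁₂) (c₂₁ : Continuous A₂₁)
    (c₂₂ : Continuous A₂₂) (h₁₁ : ∀ x, ‖A₁₁ x‖ ≤ a₁₁) (h₁₂ : ∀ x, ‖A₁₂ x‖ ≤ a₁₂)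
    (hU : IsSolutionInBall (fun x u => A₂₂ x * u + riccatiForcing ε A₁₁ A₁₂ A₂₁ x u) R U)
    (hsmall : 8 * K / μ * (ε * a₁₁) ≤ 1) {c : ℝ} (hc : 0 < c)
    (hforcing : ∀ y, ε * a₁₂ * ‖U y‖ ^ 2 + ‖A₂₁ y‖ ≤ c) (a x : ℝ) :
    ‖U x‖ ≤ 4 * K / μ * ((⨆ y : Icc (x - a) (x + a), (ε * a₁₂ * ‖U y‖ ^ 2 + ‖A₂₁ y‖)) +
      2 * c * Real.exp (-a * μ / 2)) := by
  have a₁₁_nonneg : 0 ≤ a₁₁ := (norm_nonneg _).trans (h₁₁ 0)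
  have a₁₂_nonneg : 0 ≤ a₁₂ := (norm_nonneg _).trans (h₁₂ 0)
  have forcing_bddAbove : BddAbove (range fun y : Icc (x - a) (x + a) =>
      ε * a₁₂ * ‖U y‖ ^ 2 + ‖A₂₁ y‖) := ⟨c, forall_mem_range.2 fun y => hforcing y⟩
  have forcing_le := fun y => norm_riccatiForcing_le (A₂₁ := A₂₁) hε h₁₁ h₁₂ y (U y)
  exact h.norm_le_local c₂₂ hμ
    ((continuous_riccatiForcing ε c₁₁ c₁₂ c₂₁).comp (continuous_id.prodMk hU.continuous)) hU.1
    hU.2 (Real.iSup_nonneg fun y => by positivity) hc (by positivity) hsmall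
    (fun y hy => (forcing_le y).trans (add_le_add_right (le_ciSup forcing_bddAbove ⟨y, hy⟩) _))
    fun y => (forcing_le y).trans (add_le_add_right (hforcing y) _)

theorem norm_riccati_le_iSup_of_small (h : HasExpDichotomy A₂₂ K μ) (hμ : 0 < μ)
    (hε : 0 ≤ ε) (c₁₁ : Continuous A₁₁) (c₁₂ : Continuous A₁₂) (c₂₁ : Continuous A₂₁)
    (c₂₂ : Continuous A₂₂) (h₁₁ : ∀ x, ‖A₁₁ x‖ ≤ a₁₁) (h₁₂ : ∀ x, ‖A₁₂ x‖ ≤ a₁₂)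
    (h₂₁ : ∀ x, ‖A₂₁ x‖ ≤ a₂₁)
    (hsmall : 8 * K / μ * (ε * (a₁₁ + 2 * (8 * K * μ⁻¹ * a₂₁) * a₁₂)) ≤ 1)
    (hU : IsSolutionInBall (fun x u => A₂₂ x * u + riccatiForcing ε A₁₁ A₁₂ A₂₁ x u)
      (8 * K * μ⁻¹ * a₂₁) U) {c : ℝ} (hc : 2 * a₂₁ < c) (a x : ℝ) :
    ‖U x‖ ≤ 4 * K / μ * ((⨆ y : Icc (x - a) (x + a), (ε * a₁₂ * ‖U y‖ ^ 2 + ‖A₂₁ y‖)) +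
      2 * c * Real.exp (-a * μ / 2)) := by
  have hK := h.nonneg
  have a₁₁_nonneg : 0 ≤ a₁₁ := (norm_nonneg _).trans (h₁₁ 0)
  have a₁₂_nonneg : 0 ≤ a₁₂ := (norm_nonneg _).trans (h₁₂ 0)
  have a₂₁_nonneg : 0 ≤ a₂₁ := (norm_nonneg _).trans (h₂₁ 0)
  have linear_part_small : 8 * K / μ * (ε * a₁₁) ≤ 1 := by
    refine le_trans ?_ hsmall
    gcongr
    exact le_add_of_nonneg_right (by positivity)
  exact h.norm_riccati_le_iSup hμ hε c₁₁ c₁₂ c₂₁ c₂₂ h₁₁ h₁₂ hU linear_part_small (by linarith)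
    (fun y => (forcing_le_two_mul_of_small hK hμ hε a₁₁_nonneg a₁₂_nonneg h₂₁ hU.1 hsmall y).trans
      hc.le) a x

end HasExpDichotomy

theorem periodic_riccatiTransform_of_existsUnique {L R' : ℝ}
    (hU : IsSolutionInBall (fun x u => A₂₂ x * u + riccatiForcing ε A₁₁ A₁₂ A₂₁ x u) R U)
    (U_unique : ∃! U, IsSolutionInBall
      (fun x u => A₂₂ x * u + riccatiForcing ε A₁₁ A₁₂ A₂₁ x u) R U)
    (hZ : IsSolutionInBall (fun x z => -(A₂₂ x)ᴴ * z + adjointForcing ε A₁₁ A₁₂ U x z) R' Z)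
    (Z_unique : ∃! Z, IsSolutionInBall
      (fun x z => -(A₂₂ x)ᴴ * z + adjointForcing ε A₁₁ A₁₂ U x z) R' Z)
    (p₁₁ : Function.Periodic A₁₁ L) (p₁₂ : Function.Periodic A₁₂ L)
    (p₂₁ : Function.Periodic A₂₁ L) (p₂₂ : Function.Periodic A₂₂ L) :
    Function.Periodic (riccatiTransform ε U fun x => (Z x)ᴴ) L := by
  have U_periodic : Function.Periodic U L := hU.periodic U_unique fun x v => by
    simp only [riccatiForcing, p₁₁ x, p₁₂ x, p₂₁ x, p₂₂ x]
  have Z_periodic : Function.Periodic Z L := hZ.periodic Z_unique fun x v => by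
    simp only [adjointForcing, p₁₁ x, p₁₂ x, p₂₂ x, U_periodic x]
  exact fun x => by simp only [riccatiTransform, U_periodic x, Z_periodic x]

theorem isRiccatiPair_of_hasDerivAt (c₁₁ : Continuous A₁₁) (c₁₂ : Continuous A₁₂)
    (c₂₁ : Continuous A₂₁) (c₂₂ : Continuous A₂₂)
    (hU : ∀ x, HasDerivAt U (A₂₂ x * U x + riccatiForcing ε A₁₁ A₁₂ A₂₁ x (U x)) x)
    (hZ : ∀ x, HasDerivAt Z (-(A₂₂ x)ᴴ * Z x + adjointForcing ε A₁₁ A₁₂ U x (Z x)) x) :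
    IsRiccatiPair ε A₁₁ A₁₂ A₂₁ A₂₂ U fun x => (Z x)ᴴ := by
  have cU : Continuous U := continuous_iff_continuousAt.2 fun x => (hU x).continuousAt
  have cZ : Continuous Z := continuous_iff_continuousAt.2 fun x => (hZ x).continuousAt
  have rhs_continuous : Continuous fun x => A₂₂ x * U x + riccatiForcing ε A₁₁ A₁₂ A₂₁ x (U x) :=
    (c₂₂.matrix_mul cU).add
      ((continuous_riccatiForcing ε c₁₁ c₁₂ c₂₁).comp (continuous_id.prodMk cU))
  have adjoint_rhs_continuous :
      Continuous fun x => (-(A₂₂ x)ᴴ * Z x + adjointForcing ε A₁₁ A₁₂ U x (Z x))ᴴ :=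
    ((c₂₂.matrix_conjTranspose.neg.matrix_mul cZ).add
      ((continuous_adjointForcing ε c₁₁ c₁₂ cU).comp
        (continuous_id.prodMk cZ))).matrix_conjTranspose
  have hS := fun x => hasDerivAt_matrix_conjTranspose (hZ x)
  refine ⟨contDiff_one_of_hasDerivAt hU rhs_continuous,
    contDiff_one_of_hasDerivAt hS adjoint_rhs_continuous, fun x => ?_, fun x => ?_⟩
  · convert hU x using 1
    rw [riccatiForcing]
    abel
  · convert hS x using 1
    simp only [adjointForcing, Matrix.conjTranspose_add, Matrix.conjTranspose_sub,
      Matrix.conjTranspose_mul, Matrix.conjTranspose_smul, Matrix.conjTranspose_neg,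
      Matrix.conjTranspose_conjTranspose, Matrix.mul_sub, Matrix.mul_neg, Matrix.mul_smul,
      Complex.star_def, Complex.conj_ofReal]
    abel

end Riccati

end SlowFast

open SlowFast in
theorem mainTheorem4_general :
    ∃ (C₁ : ℝ → ℝ) (C₃ : ℝ → ℝ → ℝ → ℝ → ℝ → ℝ) (C₄ : ℝ → ℝ → ℝ → ℝ → ℝ)
      (ε₁ : ℝ → ℝ → ℝ → ℝ → ℝ → ℝ),
      (∀ k, 0 < C₁ k) ∧ (∀ k m a b c, 0 < C₃ k m a b c) ∧ (∀ k m b c, 0 < C₄ k m b c) ∧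
      (∀ k m a b c, 0 < ε₁ k m a b c) ∧
      ∀ (n₁ n₂ : ℕ) (A₁₁ : ℝ → Matrix (Fin n₁) (Fin n₁) ℂ) (A₁₂ : ℝ → Matrix (Fin n₁) (Fin n₂) ℂ)
        (A₂₁ : ℝ → Matrix (Fin n₂) (Fin n₁) ℂ) (A₂₂ : ℝ → Matrix (Fin n₂) (Fin n₂) ℂ),
      Continuous A₁₁ → Continuous A₁₂ → Continuous A₂₁ → Continuous A₂₂ →
      ∀ (a₁₁ a₁₂ a₂₁ K μ : ℝ), (∀ x, ‖A₁₁ x‖ ≤ a₁₁) → (∀ x, ‖A₁₂ x‖ ≤ a₁₂) →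
      (∀ x, ‖A₂₁ x‖ ≤ a₂₁) → 0 < μ → HasExpDichotomy A₂₂ K μ →
      ∀ ε : ℝ, 0 ≤ ε → ε < ε₁ K μ a₁₁ a₁₂ a₂₁ →
        ∃ (U : ℝ → Matrix (Fin n₂) (Fin n₁) ℂ) (S : ℝ → Matrix (Fin n₁) (Fin n₂) ℂ),
          IsRiccatiPair ε A₁₁ A₁₂ A₂₁ A₂₂ U S ∧
          (∀ x, ‖U x‖ ≤ 8 * K * μ⁻¹ * a₂₁) ∧
          (∀ x, ‖S x‖ ≤ 8 * C₁ K * μ⁻¹ * a₁₂) ∧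
          Transforms (riccatiTransform ε U S) (coupled ε A₁₁ A₁₂ A₂₁ A₂₂)
            (decoupled ε A₁₁ A₁₂ A₂₂ U) ∧
          (∃ Ω : ℝ → Matrix (Fin n₂) (Fin n₁) ℂ, IsBoundedInhomSolution A₂₁ A₂₂ Ω ∧
            (∀ Ω' : ℝ → Matrix (Fin n₂) (Fin n₁) ℂ,
              IsBoundedInhomSolution A₂₁ A₂₂ Ω' → Ω' = Ω) ∧
            ∀ x, ‖U x - Ω x‖ ≤ C₃ K μ a₁₁ a₁₂ a₂₁ * ε) ∧
          (∀ a : ℝ, 0 ≤ a → ∀ x, ‖U x‖ ≤ 4 * K / μ *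
            ((⨆ y : Set.Icc (x - a) (x + a), (ε * a₁₂ * ‖U y‖ ^ 2 + ‖A₂₁ y‖)) +
              C₄ K μ a₁₂ a₂₁ * Real.exp (-a * μ / 2))) ∧
          ∀ L : ℝ, Function.Periodic A₁₁ L → Function.Periodic A₁₂ L → Function.Periodic A₂₁ L →
            Function.Periodic A₂₂ L → Function.Periodic (riccatiTransform ε U S) L := by
  refine ⟨fun k => |k| + 1,
    fun k m a b c => |2 * k / m * (a * (8 * k * m⁻¹ * c) + b * (8 * k * m⁻¹ * c) ^ 2)| + 1,
    fun _ _ _ c => 2 * (2 * |c| + 1),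
    fun k m a b c => 1 / (|8 * k / m * (a + 2 * (8 * k * m⁻¹ * c) * b)| + 1),
    fun _ => by positivity, fun _ _ _ _ _ => by positivity, fun _ _ _ _ => by positivity,
    fun _ _ _ _ _ => by positivity, ?_⟩
  intro n₁ n₂ A₁₁ A₁₂ A₂₁ A₂₂ c₁₁ c₁₂ c₂₁ c₂₂ a₁₁ a₁₂ a₂₁ K μ h₁₁ h₁₂ h₂₁ hμ hd ε hε hε₁
  have hsmall : 8 * K / μ * (ε * (a₁₁ + 2 * (8 * K * μ⁻¹ * a₂₁) * a₁₂)) ≤ 1 := by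
    rw [mul_left_comm]
    exact mul_le_one_of_lt_one_div hε hε₁
  have U_existsUnique := hd.existsUnique_riccati hμ hε c₁₁ c₁₂ c₂₁ c₂₂ h₁₁ h₁₂ h₂₁ hsmall
  obtain ⟨U, hU⟩ := U_existsUnique.exists
  have Z_existsUnique :=
    hd.existsUnique_adjointRiccati hμ hε c₁₁ c₁₂ c₂₂ hU.continuous h₁₁ h₁₂ hU.1 hsmall
  obtain ⟨Z, hZ⟩ := Z_existsUnique.exists
  obtain ⟨Ω, hΩ, Ω_unique⟩ := hd.existsUnique_isBoundedInhomSolution hμ c₂₁ c₂₂ h₂₁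
  have a₁₂_nonneg : 0 ≤ a₁₂ := (norm_nonneg _).trans (h₁₂ 0)
  have hpair := isRiccatiPair_of_hasDerivAt c₁₁ c₁₂ c₂₁ c₂₂ hU.2 hZ.2
  refine ⟨U, fun x => (Z x)ᴴ, hpair, hU.1, fun x => ?_, hpair.transforms,
    ⟨Ω, hΩ, Ω_unique, fun x => ?_⟩,
    fun a _ => hd.norm_riccati_le_iSup_of_small hμ hε c₁₁ c₁₂ c₂₁ c₂₂ h₁₁ h₁₂ h₂₁ hsmall hU
      (by linarith [le_abs_self a₂₁]) a,
    fun L => periodic_riccatiTransform_of_existsUnique hU U_existsUnique hZ Z_existsUnique⟩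
  · rw [Matrix.l2_opNorm_conjTranspose]
    refine (hZ.1 x).trans ?_
    gcongr
    linarith [le_abs_self K]
  · refine (hd.norm_riccati_sub_inhomSolution_le hμ hε c₁₁ c₁₂ c₂₁ c₂₂ h₁₁ h₁₂ hU hΩ x).trans ?_
    gcongr
    exact (le_abs_self _).trans (le_add_of_nonneg_right zero_le_one)

open SlowFast in
theorem mainTheorem4 :
    -- the constants: `C₁` depends on `K₀`; `C₃` on `K₀, μ₀, ‖A₁₁‖, ‖A₁₂‖, ‖A₂₁‖`;
    -- `C₄` on `K₀, μ₀, ‖A₁₂‖, ‖A₂₁‖`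
    ∃ (C₁ : ℝ → ℝ) (C₃ : ℝ → ℝ → ℝ → ℝ → ℝ → ℝ) (C₄ : ℝ → ℝ → ℝ → ℝ → ℝ),
      (∀ k, 0 < C₁ k) ∧ (∀ k m a b c, 0 < C₃ k m a b c) ∧ (∀ k m b c, 0 < C₄ k m b c) ∧
      ∀ (n₁ n₂ : ℕ), 0 < n₁ → 0 < n₂ →
      ∀ (ε₀ : ℝ), 0 < ε₀ →
      ∀ (A₁₁ : (ℝ × Set.Ioo (0 : ℝ) ε₀) →ᵇ Matrix (Fin n₁) (Fin n₁) ℂ)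
        (A₁₂ : (ℝ × Set.Ioo (0 : ℝ) ε₀) →ᵇ Matrix (Fin n₁) (Fin n₂) ℂ)
        (A₂₁ : (ℝ × Set.Ioo (0 : ℝ) ε₀) →ᵇ Matrix (Fin n₂) (Fin n₁) ℂ)
        (A₂₂ : (ℝ × Set.Ioo (0 : ℝ) ε₀) →ᵇ Matrix (Fin n₂) (Fin n₂) ℂ)
        (K₀ μ₀ : ℝ), 0 < K₀ → 0 < μ₀ →
      (∀ ε : Set.Ioo (0 : ℝ) ε₀, HasExpDichotomy (fun x => A₂₂ (x, ε)) K₀ μ₀) →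
      ∃ ε₁ : ℝ, 0 < ε₁ ∧ ∀ ε : Set.Ioo (0 : ℝ) ε₀, (ε : ℝ) < ε₁ →
        ∃ (U : ℝ → Matrix (Fin n₂) (Fin n₁) ℂ) (S : ℝ → Matrix (Fin n₁) (Fin n₂) ℂ),
          IsRiccatiPair (ε : ℝ) (fun x => A₁₁ (x, ε)) (fun x => A₁₂ (x, ε))
            (fun x => A₂₁ (x, ε)) (fun x => A₂₂ (x, ε)) U S ∧
          -- 1. uniform bounds
          (∀ x, ‖U x‖ ≤ 8 * K₀ * μ₀⁻¹ * ‖A₂₁‖) ∧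
          (∀ x, ‖S x‖ ≤ 8 * C₁ K₀ * μ₀⁻¹ * ‖A₁₂‖) ∧
          -- 2. block diagonalization
          Transforms (riccatiTransform (ε : ℝ) U S)
            (coupled (ε : ℝ) (fun x => A₁₁ (x, ε)) (fun x => A₁₂ (x, ε))
              (fun x => A₂₁ (x, ε)) (fun x => A₂₂ (x, ε)))
            (decoupled (ε : ℝ) (fun x => A₁₁ (x, ε)) (fun x => A₁₂ (x, ε))
              (fun x => A₂₂ (x, ε)) U) ∧
          -- 3. closeness to the unique bounded solution of the inhomogeneous problem
          (∃ Ω : ℝ → Matrix (Fin n₂) (Fin n₁) ℂ,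
            IsBoundedInhomSolution (fun x => A₂₁ (x, ε)) (fun x => A₂₂ (x, ε)) Ω ∧
            (∀ Ω' : ℝ → Matrix (Fin n₂) (Fin n₁) ℂ,
              IsBoundedInhomSolution (fun x => A₂₁ (x, ε)) (fun x => A₂₂ (x, ε)) Ω' → Ω' = Ω) ∧
            ∀ θ : ℝ, 0 < θ → θ < 1 → ∀ x,
              ‖U x - Ω x‖ ≤ C₃ K₀ μ₀ ‖A₁₁‖ ‖A₁₂‖ ‖A₂₁‖ * (ε : ℝ) ^ (1 - θ)) ∧
          -- 4. local estimate
          (∀ a : ℝ, 0 < a → ∀ x,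
            ‖U x‖ ≤ 4 * K₀ / μ₀ *
              ((⨆ y : Set.Icc (x - a) (x + a),
                  ((ε : ℝ) * ‖A₁₂‖ * ‖U y‖ ^ 2 + ‖A₂₁ ((y : ℝ), ε)‖)) +
                C₄ K₀ μ₀ ‖A₁₂‖ ‖A₂₁‖ * Real.exp (-a * μ₀ / 2))) ∧
          -- 5. periodicity
          (∀ L : ℝ,
            Function.Periodic (fun x => A₁₁ (x, ε)) L →
            Function.Periodic (fun x => A₁₂ (x, ε)) L →
            Function.Periodic (fun x => A₂₁ (x, ε)) L →
            Function.Periodic (fun x => A₂₂ (x, ε)) L →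
            Function.Periodic (riccatiTransform (ε : ℝ) U S) L) := by
  obtain ⟨C₁, C₃, C₄, ε₁, hC₁, hC₃, hC₄, hε₁, main⟩ := mainTheorem4_general
  refine ⟨C₁, C₃, C₄, hC₁, hC₃, hC₄, fun n₁ n₂ _ _ ε₀ _ A₁₁ A₁₂ A₂₁ A₂₂ K₀ μ₀ _ hμ hd =>
    ⟨min 1 (ε₁ K₀ μ₀ ‖A₁₁‖ ‖A₁₂‖ ‖A₂₁‖), lt_min one_pos (hε₁ _ _ _ _ _), fun ε hε => ?_⟩⟩
  obtain ⟨hε_one, hε_small⟩ := lt_min_iff.1 hε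
  obtain ⟨U, S, hpair, hU, hS, htransforms, ⟨Ω, hΩ, hΩ_unique, hclose⟩, hlocal, hperiodic⟩ :=
    main n₁ n₂ _ _ _ _ (A₁₁.continuous.comp (by fun_prop)) (A₁₂.continuous.comp (by fun_prop))
      (A₂₁.continuous.comp (by fun_prop)) (A₂₂.continuous.comp (by fun_prop)) _ _ _ K₀ μ₀
      (fun x => A₁₁.norm_coe_le_norm (x, ε)) (fun x => A₁₂.norm_coe_le_norm (x, ε))
      (fun x => A₂₁.norm_coe_le_norm (x, ε)) hμ (hd ε) ε ε.2.1.le hε_small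
  refine ⟨U, S, hpair, hU, hS, htransforms, ⟨Ω, hΩ, hΩ_unique, fun θ hθ _ x => ?_⟩,
    fun a ha => hlocal a ha.le, hperiodic⟩
  have hε_rpow : (ε : ℝ) ≤ (ε : ℝ) ^ (1 - θ) :=
    Real.self_le_rpow_of_le_one ε.2.1.le hε_one.le (by linarith)
  exact (hclose x).trans (mul_le_mul_of_nonneg_left hε_rpow (hC₃ _ _ _ _ _).le)
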